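/- There are absolute constants $c_0, C_0 > 0$ such that for every $C \ge C_0$ the following holds. Let $G=(V,E)$ be any finite directed graph without self-loops, with $m=|V|$ vertices, $m'=|E|$ edges, and let $\Delta$ be the larger of its maximum out-degree and its maximum in-degree. Let $d_{\mathrm{model}} \ge 1$ be an integer with $d_{\mathrm{model}} \ge c_0 \log m$, and put $H=\lceil m'/d_{\mathrm{model}}\rceil+\Delta$, $d_k=\lceil C\log m\rceil$, $\tau=\tfrac12 d_k$. Call a set of edges a matching if no two of its edges share a source or share a target. A packing is a partition of $E$ into $H$ disjoint (possibly empty) matchings $M_1,\dots,M_H$ with $|M_k|\le d_{\mathrm{model}}$. Given a packing, let $V_k$ and $T_k$ be the sets of sources and targets of $M_k$ and $\pi_k:V_k\to T_k$ the bijection that $M_k$ defines. Let $X\in\mathbb{R}^{m\times d_{\mathrm{model}}}$ have independent rows $\mathbf{x}_i=\tilde{\mathbf{x}}_i/\|\tilde{\mathbf{x}}_i\|_2$ with $\tilde{\mathbf{x}}_i\sim\mathcal{N}(0,I/d_{\mathrm{model}})$, and let $W\in\{\pm1\}^{m\times d_k}$, independent of $X$, have i.i.d. uniform signs as entries and rows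 $\mathbf{w}_j$. For a packing and each $k$ set $W_Q^{(k)}=X^\top W'_{Q,(k)}$ and $W_K^{(k)}=X^\top W'_{K,(k)}$, where row $i$ of $W'_{Q,(k)}$ is $\mathbf{w}_{\pi_k(i)}$ if $i\in V_k$ and $\mathbf{0}$ otherwise, and row $j$ of $W'_{K,(k)}$ is $\mathbf{w}_j$ if $j\in T_k$ and $\mathbf{0}$ otherwise. Put $S_{ij}^{(k)}=\langle \mathbf{x}_iW_Q^{(k)},\mathbf{x}_jW_K^{(k)}\rangle$ and $S_{ij}^{\max}=\max_{1\le k\le H}S_{ij}^{(k)}$ (which is $-\infty$ if $H=0$). Then: (1) There is a colouring of $E$ with $\Delta$ colours in which different edges that share a source or share a target have different colours, together with a packing each of whose matchings consists of edges of a single colour. (2) For every packing, with probability at least $1-m^{-3}$ over the draw of $(X,W)$, simultaneously for all ordered pairs $(i,j)\in V\times V$: $S_{ij}^{\max}>\tau$ if $(i,j)\in E$, and $S_{ij}^{\max}<\tau$ if $(i,j)\notin E$. (3) The total key dimension $D_K=H\,d_k$ satisfies $D_K\le K\left(\frac{m'}{d_{\mathrm{model}}}+\Delta\right)\log m$, where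 $K$ depends only on $C$. -/

import Mathlib

open MeasureTheory ProbabilityTheory
open scoped NNReal ENNReal Matrix

noncomputable section

namespace RGR

/-! ### Directed graphs, edge colourings, packings into matchings -/

section Graph

variable {V : Type*} [Fintype V]

/-- The set of edges of a finite directed graph, as a set of ordered pairs (source, target). -/
def edges (G : Digraph V) : Finset (V × V) := by
  classical exact Finset.univ.filter fun e => G.Adj e.1 e.2

/-- The number `m'` of edges. -/
def numEdges (G : Digraph V) : ℕ := (edges G).card

/-- Out-degree of a vertex. -/
def outDegree (G : Digraph V) (v : V) : ℕ := by
  classical exact (Finset.univ.filter fun u => G.Adj v u).card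

/-- In-degree of a vertex. -/
def inDegree (G : Digraph V) (v : V) : ℕ := by
  classical exact (Finset.univ.filter fun u => G.Adj u v).card

/-- `Δ`, the larger one of the maximum out-degree and the maximum in-degree. -/
def maxDegree (G : Digraph V) : ℕ :=
  max (Finset.univ.sup (outDegree G)) (Finset.univ.sup (inDegree G))

/-- Two different edges that share their source or share their target. (These are the edges that
meet in the bipartite incidence graph, which has a left and a right copy of every vertex.) -/
def Conflict (e f : V × V) : Prop := e ≠ f ∧ (e.1 = f.1 ∨ e.2 = f.2)

/-- A matching: no two edges share a source or a target. -/
def IsMatching (M : Finset (V × V)) : Prop := ∀ e ∈ M, ∀ f ∈ M, ¬ Conflict e f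

/-- A proper colouring of the edges (of the bipartite incidence graph) of `G` with the
colours `0, …, n - 1`. -/
def IsEdgeColoring (G : Digraph V) (n : ℕ) (col : V × V → ℕ) : Prop :=
  (∀ e ∈ edges G, col e < n) ∧
    ∀ e ∈ edges G, ∀ f ∈ edges G, Conflict e f → col e ≠ col f

/-- A partition of the edges of `G` into `h` disjoint (possibly empty) matchings of size
at most `d`. -/
structure EdgePacking (G : Digraph V) (d h : ℕ) where
  M : Fin h → Finset (V × V)
  disjoint : ∀ k l, k ≠ l → Disjoint (M k) (M l)
  mem_iff : ∀ e, e ∈ edges G ↔ ∃ k, e ∈ M k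
  matching : ∀ k, IsMatching (M k)
  card_le : ∀ k, (M k).card ≤ d

/-- The number of heads, `H = ⌈m' / d⌉ + Δ`. -/
def numHeads (G : Digraph V) (d : ℕ) : ℕ := ⌈(numEdges G : ℝ) / (d : ℝ)⌉₊ + maxDegree G

end Graph

/-! ### The key-query channel of multi-head attention -/

/-- Key and query weights of `h` heads of width `dk` over model dimension `d`, together with a
global threshold. -/
structure AttentionParams (d h dk : ℕ) where
  WQ : Fin h → Matrix (Fin d) (Fin dk) ℝ
  WK : Fin h → Matrix (Fin d) (Fin dk) ℝ
  τ : ℝ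

namespace AttentionParams

variable {V : Type*} {d h dk : ℕ}

/-- The total key dimension `D_K = h * dk`. -/
def totalKeyDim (_ : AttentionParams d h dk) : ℕ := h * dk

/-- The query of item `i` in head `k`, where row `i` of `X` is the embedding of item `i`. -/
def query (A : AttentionParams d h dk) (X : Matrix V (Fin d) ℝ) (k : Fin h) (i : V) :
    Fin dk → ℝ := X i ᵥ* A.WQ k

/-- The key of item `j` in head `k`. -/
def key (A : AttentionParams d h dk) (X : Matrix V (Fin d) ℝ) (k : Fin h) (j : V) :
    Fin dk → ℝ := X j ᵥ* A.WK k

/-- The score of the pair `(i, j)` in head `k`. -/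
def score (A : AttentionParams d h dk) (X : Matrix V (Fin d) ℝ) (k : Fin h) (i j : V) : ℝ :=
  A.query X k i ⬝ᵥ A.key X k j

/-- The aggregated score, the maximum over the heads (`⊥ = -∞` if there is no head). -/
def scoreMax (A : AttentionParams d h dk) (X : Matrix V (Fin d) ℝ) (i j : V) : EReal :=
  ⨆ k, ((A.score X k i j : ℝ) : EReal)

end AttentionParams

/-! ### The construction -/

section Construction

variable {V : Type*} [Fintype V] {dk : ℕ}

/-- One-hot query template of a matching `M` (with associated bijection `π` from its sources to
its targets): row `i` is the signature of `π i` if `i` is a source of `M`, and `0` otherwise. -/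
def queryTemplate (M : Finset (V × V)) (W : Matrix V (Fin dk) ℝ) : Matrix V (Fin dk) ℝ := by
  classical exact fun i => if hi : ∃ j, (i, j) ∈ M then W hi.choose else 0

/-- One-hot key template: row `j` is the signature of `j` if `j` is a target of `M`, and `0`
otherwise. -/
def keyTemplate (M : Finset (V × V)) (W : Matrix V (Fin dk) ℝ) : Matrix V (Fin dk) ℝ := by
  classical exact fun j => if ∃ i, (i, j) ∈ M then W j else 0

/-- Attention parameters built from a packing of the edges into matchings, one head per matching,
the embedding matrix `X` and the signature matrix `W`. -/
def construction {G : Digraph V} {d h : ℕ} (P : EdgePacking G d h)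
    (X : Matrix V (Fin d) ℝ) (W : Matrix V (Fin dk) ℝ) : AttentionParams d h dk where
  WQ k := Xᵀ * queryTemplate (P.M k) W
  WK k := Xᵀ * keyTemplate (P.M k) W
  τ := (dk : ℝ) / 2

end Construction

/-! ### The random draw -/

section Draw

/-- Rescale every row of a matrix to Euclidean norm one. -/
def normalizeRows {V : Type*} {d : ℕ} (Y : V → Fin d → ℝ) : V → Fin d → ℝ :=
  fun i a => Y i a / Real.sqrt (∑ b, Y i b ^ 2)

/-- The uniform distribution on `{1, -1}`. -/
def rademacher : Measure ℝ := (2⁻¹ : ℝ≥0∞) • Measure.dirac 1 + (2⁻¹ : ℝ≥0∞) • Measure.dirac (-1)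

variable (V : Type*) [Fintype V] (d dk : ℕ)

/-- The law of a matrix with independent rows `N(0, I / d)`. -/
def gaussianMatrix : Measure (V → Fin d → ℝ) :=
  Measure.pi fun _ => Measure.pi fun _ => gaussianReal 0 ((d : ℝ≥0)⁻¹)

/-- The law of a matrix with independent Rademacher entries. -/
def rademacherMatrix : Measure (V → Fin dk → ℝ) :=
  Measure.pi fun _ => Measure.pi fun _ => rademacher

/-- The joint law of the independent pair (Gaussian unit-norm embedding matrix, signature
matrix). -/
def drawLaw : Measure ((V → Fin d → ℝ) × (V → Fin dk → ℝ)) :=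
  ((gaussianMatrix V d).map normalizeRows).prod (rademacherMatrix V dk)

end Draw

/-- The parameters `A` separate the edges of `G` from the non-edges under the embedding `X`. -/
def Separates {V : Type*} {d h dk : ℕ} (G : Digraph V) (A : AttentionParams d h dk)
    (X : Matrix V (Fin d) ℝ) : Prop :=
  ∀ i j, (G.Adj i j → (A.τ : EReal) < A.scoreMax X i j) ∧
    (¬ G.Adj i j → A.scoreMax X i j < (A.τ : EReal))

/-- The width `⌈C log m⌉` of a head. -/
def headWidth (C : ℝ) (m : ℕ) : ℕ := ⌈C * Real.log m⌉₊

end RGR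

end

/-! Fix a head with matching `M` and a pair `(i, j)`. The score is a sum over the `dk` signature
columns of products of two linear forms in signs, with coefficients `⟨x_i, x_s⟩` and `⟨x_j, x_t⟩`
over the edges `(s, t)` of `M` (`score_construction`). Given `X`, its mean is `dk` times `μ = ∑
⟨x_i, x_s⟩⟨x_j, x_t⟩`, because distinct edges have distinct targets. The columns are independent
and, as long as both coefficient vectors have bounded norm, sub-exponential; so the score is within
`dk / 8` of its mean up to a probability exponentially small in `dk` (`measure_abs_bilinear_ge_le`).

It remains that `μ` is within `1 / 4` of the indicator of `(i, j) ∈ M`, up to a probability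
exponentially small in `d` (`measure_not_goodEmbedding_le`). At most four edges meet `i` or `j`, and
near-orthogonality of the rows handles each of them. The others split into three classes of pairwise
vertex-disjoint edges (`exists_three_colouring`); given `x_i` and `x_j`, the terms of one class are
independent and centred, so Chernoff applies, with exponential moments coming from
`lintegral_eexp_sq_rowLaw_le`.

The total error is below `dk / 2`, so the threshold separates. A union bound over all heads and
pairs, `O(m ^ 4)` events, finishes the probabilistic part once `d` and `dk` are large multiples of
`log m`.

The packing is König's edge colouring, obtained by completing the adjacency matrix to one with
constant row and column sums and peeling off permutations by Hall; each colour class is then cut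
into blocks of size `d`. -/

namespace RGR

/-! ### König's theorem, batching, and the number of heads -/

section EdgeColouring

variable {V : Type*} [Fintype V]

/-- Hall's theorem for natural matrices with constant positive row and column sums. -/
theorem exists_perm_forall_pos (A : V → V → ℕ) {n : ℕ} (hn : 0 < n)
    (hr : ∀ i, ∑ j, A i j = n) (hc : ∀ j, ∑ i, A i j = n) :
    ∃ σ : Equiv.Perm V, ∀ i, 0 < A i (σ i) := by
  classical
  let f (i : V) : Finset V := Finset.univ.filter fun j => 0 < A i j
  -- Double counting: the rows in `S` put their whole mass `n * |S|` into neighbouring columns,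
  -- which hold `n` each.
  have hall : ∀ S : Finset V, S.card ≤ (S.biUnion f).card := by
    intro S
    have h1 : ∀ i ∈ S, ∑ j ∈ S.biUnion f, A i j = n := by
      intro i hi
      rw [← hr i]
      refine Finset.sum_subset (Finset.subset_univ _) fun j _ hj => ?_
      by_contra h
      exact hj (Finset.mem_biUnion.2 ⟨i, hi, by simp [f]; omega⟩)
    have h2 : S.card * n ≤ (S.biUnion f).card * n := by
      calc S.card * n = ∑ i ∈ S, ∑ j ∈ S.biUnion f, A i j := by
            rw [Finset.sum_congr rfl h1]; simp
        _ ≤ ∑ i, ∑ j ∈ S.biUnion f, A i j :=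
            Finset.sum_le_sum_of_subset (Finset.subset_univ _)
        _ = (S.biUnion f).card * n := by
            rw [Finset.sum_comm, Finset.sum_congr rfl fun j _ => hc j]; simp
    exact Nat.le_of_mul_le_mul_right h2 hn
  obtain ⟨g, hg, hg'⟩ := (Finset.all_card_le_biUnion_card_iff_exists_injective f).1 hall
  refine ⟨Equiv.ofBijective g (Finite.injective_iff_bijective.1 hg), fun i => ?_⟩
  simpa [f] using hg' i

/-- The support of a natural matrix with row and column sums `n` is covered by `n` permutations. -/
theorem exists_perms_cover (n : ℕ) : ∀ (A : V → V → ℕ),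
    (∀ i, ∑ j, A i j = n) → (∀ j, ∑ i, A i j = n) →
    ∃ σ : Fin n → Equiv.Perm V, ∀ i j, 0 < A i j → ∃ c, σ c i = j := by
  classical
  induction n with
  | zero =>
    intro A hr _
    refine ⟨fun _ => 1, fun i j h => ?_⟩
    have := (Finset.sum_eq_zero_iff.1 (hr i)) j (Finset.mem_univ j)
    omega
  | succ n ih =>
    intro A hr hc
    obtain ⟨σ, hσ⟩ := exists_perm_forall_pos A n.succ_pos hr hc
    have hle : ∀ i j, (if σ i = j then 1 else 0) ≤ A i j := by
      intro i j
      split_ifs with h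
      · subst h; exact hσ i
      · exact Nat.zero_le _
    -- The permutation matrix of `σ` lies below `A`, so the truncated subtraction is exact and every
    -- row and column sum drops by one.
    obtain ⟨ρ, hρ⟩ := ih (fun i j => A i j - if σ i = j then 1 else 0)
      (fun i => by
        rw [Finset.sum_tsub_distrib _ fun j _ => hle i j, hr i]; simp)
      (fun j => by
        rw [Finset.sum_tsub_distrib _ fun i _ => hle i j, hc j]
        have : ∑ i, (if σ i = j then 1 else 0) = 1 := by
          rw [Finset.sum_eq_single (σ.symm j)]
          · simp
          · intro i _ hi
            rw [if_neg]
            rintro rfl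
            simp at hi
          · simp
        omega)
    refine ⟨Fin.cons σ ρ, fun i j h => ?_⟩
    by_cases hij : σ i = j
    · exact ⟨0, by simpa using hij⟩
    · obtain ⟨c, hc⟩ := hρ i j (by simpa [hij] using h)
      exact ⟨c.succ, by simpa using hc⟩

/-- A natural matrix with row and column sums at most `n` is dominated by one with row and column
sums equal to `n`. -/
theorem exists_regular_extension {n : ℕ} : ∀ (t : ℕ) (A : V → V → ℕ),
    (∀ i, ∑ j, A i j ≤ n) → (∀ j, ∑ i, A i j ≤ n) →
    Fintype.card V * n - ∑ i, ∑ j, A i j = t →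
    ∃ B : V → V → ℕ, (∀ i j, A i j ≤ B i j) ∧ (∀ i, ∑ j, B i j = n) ∧ ∀ j, ∑ i, B i j = n := by
  classical
  intro t
  induction t with
  | zero =>
    intro A hr hc ht
    have htot : ∑ i, ∑ j, A i j = ∑ _i : V, n :=
      le_antisymm (Finset.sum_le_sum fun i _ => hr i) (by simp; omega)
    have htot' : ∑ j, ∑ i, A i j = ∑ _j : V, n := by rw [Finset.sum_comm, htot]
    refine ⟨A, fun _ _ => le_rfl, fun i => ?_, fun j => ?_⟩
    · exact (Finset.sum_eq_sum_iff_of_le fun i _ => hr i).1 htot i (Finset.mem_univ i)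
    · exact (Finset.sum_eq_sum_iff_of_le fun j _ => hc j).1 htot' j (Finset.mem_univ j)
  | succ t ih =>
    intro A hr hc ht
    have hlt : ∑ i, ∑ j, A i j < ∑ _i : V, n := by simp; omega
    -- A positive deficit leaves slack in some row and in some column. Raising the entry where they
    -- cross may create a multiple edge, hence matrices over `ℕ`.
    obtain ⟨i₀, -, hi₀⟩ := Finset.exists_lt_of_sum_lt hlt
    obtain ⟨j₀, -, hj₀⟩ := Finset.exists_lt_of_sum_lt (Finset.sum_comm.trans_lt hlt)
    let D (i j : V) : ℕ := if i = i₀ then (if j = j₀ then 1 else 0) else 0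
    have hDr : ∀ i, ∑ j, D i j = if i = i₀ then 1 else 0 := by
      intro i; by_cases h : i = i₀ <;> simp [D, h]
    have hDc : ∀ j, ∑ i, D i j = if j = j₀ then 1 else 0 := by
      intro j; by_cases h : j = j₀ <;> simp [D, h]
    obtain ⟨B, hAB, hB⟩ := ih (fun i j => A i j + D i j)
      (fun i => by
        rw [Finset.sum_add_distrib, hDr]
        split_ifs with h
        · subst h; omega
        · simpa using hr i)
      (fun j => by
        rw [Finset.sum_add_distrib, hDc]
        split_ifs with h
        · subst h; omega
        · simpa using hc j)
      (by
        have : ∑ i, ∑ j, (A i j + D i j) = ∑ i, ∑ j, A i j + 1 := by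
          simp [Finset.sum_add_distrib, hDr]
        omega)
    exact ⟨B, fun i j => (Nat.le_add_right _ _).trans (hAB i j), hB⟩

/-- König's edge colouring theorem for the bipartite incidence graph of a directed graph. -/
theorem exists_edgeColoring (G : Digraph V) :
    ∃ col : V × V → ℕ, IsEdgeColoring G (maxDegree G) col := by
  classical
  obtain ⟨B, hAB, hr, hc⟩ := exists_regular_extension (n := maxDegree G) _
    (fun i j => if G.Adj i j then 1 else 0)
    (fun i => by
      have h : outDegree G i ≤ maxDegree G :=
        (Finset.le_sup (f := outDegree G) (Finset.mem_univ i)).trans (le_max_left _ _)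
      rw [Finset.sum_boole]
      refine le_trans (le_of_eq ?_) h
      simp [outDegree])
    (fun j => by
      have h : inDegree G j ≤ maxDegree G :=
        (Finset.le_sup (f := inDegree G) (Finset.mem_univ j)).trans (le_max_right _ _)
      rw [Finset.sum_boole]
      refine le_trans (le_of_eq ?_) h
      simp [inDegree])
    rfl
  obtain ⟨σ, hσ⟩ := exists_perms_cover _ B hr hc
  have hex : ∀ e ∈ edges G, ∃ c, σ c e.1 = e.2 := by
    intro e he
    have hadj : G.Adj e.1 e.2 := by simpa [edges] using he
    exact hσ _ _ (lt_of_lt_of_le (by simp [hadj]) (hAB e.1 e.2))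
  -- The colour of an edge is the index of a permutation containing it; the default `0` is never
  -- reached on an edge.
  let col (e : V × V) : ℕ := if h : ∃ c, σ c e.1 = e.2 then h.choose.1 else 0
  have hcol : ∀ e ∈ edges G, ∃ c, col e = c.1 ∧ σ c e.1 = e.2 := by
    intro e he
    have h := hex e he
    exact ⟨h.choose, by simp only [col, dif_pos h], h.choose_spec⟩
  refine ⟨col, fun e he => ?_, fun e he f hf hef heq => ?_⟩
  · obtain ⟨c, h, -⟩ := hcol e he
    exact h ▸ c.2
  · obtain ⟨c, hc1, hc2⟩ := hcol e he
    obtain ⟨c', hc1', hc2'⟩ := hcol f hf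
    obtain rfl : c = c' := Fin.ext (by omega)
    refine hef.1 (Prod.ext_iff.2 ?_)
    rcases hef.2 with h | h
    · exact ⟨h, by rw [← hc2, ← hc2', h]⟩
    · exact ⟨(σ c).injective (by rw [hc2, hc2', h]), h⟩

/-- The classes of a function on a finite set can be split into batches of size at most `d`, using
at most `|E| / d + n` batches if the function takes its values below `n`. -/
theorem exists_batches {α : Type*} (E : Finset α) (col : α → ℕ) {d n : ℕ}
    (hd : 1 ≤ d) (hcol : ∀ e ∈ E, col e < n) :
    ∃ b : α → ℕ, (∀ e ∈ E, b e < E.card / d + n) ∧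
      (∀ e ∈ E, ∀ f ∈ E, b e = b f → col e = col f) ∧
      ∀ k, (E.filter fun e => b e = k).card ≤ d := by
  classical
  let S (c : ℕ) : Finset α := E.filter fun e => col e = c
  have hex : ∀ c, ∃ g : α → ℕ, (∀ e ∈ S c, g e < (S c).card) ∧ Set.InjOn g (S c) := by
    intro c
    refine ⟨fun e => if h : e ∈ S c then ((S c).equivFin ⟨e, h⟩).1 else 0, fun e he => ?_,
      fun e he f hf h => ?_⟩
    · simp only [dif_pos he]
      exact Fin.is_lt _
    · rw [Finset.mem_coe] at he hf
      simp only [dif_pos he, dif_pos hf] at h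
      simpa using (S c).equivFin.injective (Fin.ext h)
  choose g hg1 hg2 using hex
  let idx (e : α) : ℕ := g (col e) e
  have hidx : ∀ e ∈ E, idx e < (S (col e)).card := fun e he => hg1 _ e (by simp [S, he])
  have hinj : ∀ e ∈ E, ∀ f ∈ E, col e = col f → idx e = idx f → e = f := by
    intro e he f hf hc hi
    simp only [idx, ← hc] at hi
    exact hg2 (col e) (by simp [S, he]) (by simp [S, hf, hc]) hi
  -- Labels are pairs (colour, block). The one extra block per colour covers the remainder of the
  -- division and costs `n` in total.
  let T : Finset (Σ _ : ℕ, ℕ) :=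
    (Finset.range n).sigma fun c => Finset.range ((S c).card / d + 1)
  have hT : T.card ≤ E.card / d + n := by
    have h1 : ∑ c ∈ Finset.range n, (S c).card = E.card := by
      rw [Finset.card_eq_sum_card_fiberwise (t := Finset.range n) (f := col)]
      intro e he
      simpa using hcol e he
    have h2 : ∑ c ∈ Finset.range n, (S c).card / d ≤ E.card / d := by
      rw [Nat.le_div_iff_mul_le hd, Finset.sum_mul, ← h1]
      exact Finset.sum_le_sum fun c _ => Nat.div_mul_le_self _ _
    simp only [T, Finset.card_sigma, Finset.card_range, Finset.sum_add_distrib]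
    simpa using h2
  have hkey : ∀ e ∈ E, (⟨col e, idx e / d⟩ : Σ _ : ℕ, ℕ) ∈ T := by
    intro e he
    simp only [T, Finset.mem_sigma, Finset.mem_range]
    exact ⟨hcol e he, Nat.lt_succ_of_le (Nat.div_le_div_right (hidx e he).le)⟩
  let b (e : α) : ℕ :=
    if h : (⟨col e, idx e / d⟩ : Σ _ : ℕ, ℕ) ∈ T then (T.equivFin ⟨_, h⟩).1 else 0
  have hb : ∀ e ∈ E, ∀ f ∈ E, b e = b f → col e = col f ∧ idx e / d = idx f / d := by
    intro e he f hf h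
    simp only [b, dif_pos (hkey e he), dif_pos (hkey f hf)] at h
    have := T.equivFin.injective (Fin.ext h)
    simpa using this
  refine ⟨b, fun e he => ?_, fun e he f hf h => (hb e he f hf h).1, fun k => ?_⟩
  · simp only [b, dif_pos (hkey e he)]
    exact (Fin.is_lt _).trans_le hT
  · rcases (E.filter fun e => b e = k).eq_empty_or_nonempty with h | ⟨e, he⟩
    · simp [h]
    · rw [Finset.mem_filter] at he
      have hdiv : ∀ f ∈ E.filter fun e => b e = k, col f = col e ∧ idx f / d = idx e / d := by
        intro f hf
        rw [Finset.mem_filter] at hf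
        exact hb f hf.1 e he.1 (hf.2.trans he.2.symm)
      have hcard := Finset.card_le_card_of_injOn
        (s := E.filter fun e => b e = k)
        (t := Finset.Ico (idx e / d * d) (idx e / d * d + d)) idx
        (fun f hf => by
          have h := (hdiv f hf).2
          have h1 := Nat.div_mul_le_self (idx f) d
          have h2 := Nat.lt_div_mul_add (a := idx f) (b := d) hd
          rw [h] at h1 h2
          simp only [Finset.coe_Ico, Set.mem_Ico]
          exact ⟨h1, h2⟩)
        (fun f hf g hg h => hinj f (Finset.mem_filter.1 hf).1 g (Finset.mem_filter.1 hg).1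
          ((hdiv f hf).1.trans (hdiv g hg).1.symm) h)
      simpa using hcard

/-- An edge colouring with `Δ` colours together with a packing into monochromatic matchings. -/
theorem exists_edgeColoring_and_packing (G : Digraph V) {d : ℕ} (hd : 1 ≤ d) :
    ∃ col : V × V → ℕ, IsEdgeColoring G (maxDegree G) col ∧
      ∃ P : EdgePacking G d (numHeads G d), ∀ k, ∀ e ∈ P.M k, ∀ f ∈ P.M k, col e = col f := by
  classical
  obtain ⟨col, hcol⟩ := exists_edgeColoring G
  obtain ⟨b, hb1, hb2, hb3⟩ := exists_batches (edges G) col hd hcol.1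
  -- The batches use a floor and the heads a ceiling; surplus heads receive empty matchings.
  have hle : (edges G).card / d + maxDegree G ≤ numHeads G d := by
    refine Nat.add_le_add_right ?_ _
    have h1 : (((edges G).card / d : ℕ) : ℝ) ≤ (numEdges G : ℝ) / d := Nat.cast_div_le
    exact_mod_cast h1.trans (Nat.le_ceil _)
  refine ⟨col, hcol, ⟨fun k => (edges G).filter fun e => b e = k, ?_, ?_, ?_, fun k => hb3 k⟩, ?_⟩
  · intro k l hkl
    rw [Finset.disjoint_left]
    intro e he hf
    rw [Finset.mem_filter] at he hf
    exact hkl (Fin.ext (he.2.symm.trans hf.2))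
  · intro e
    constructor
    · intro he
      exact ⟨⟨b e, (hb1 e he).trans_le hle⟩, by simp [he]⟩
    · rintro ⟨k, hk⟩
      exact (Finset.mem_filter.1 hk).1
  · intro k e he f hf hef
    rw [Finset.mem_filter] at he hf
    exact hcol.2 e he.1 f hf.1 hef (hb2 e he.1 f hf.1 (he.2.trans hf.2.symm))
  · intro k e he f hf
    simp only [Finset.mem_filter] at he hf
    exact hb2 e he.1 f hf.1 (he.2.trans hf.2.symm)

/-- A matching splits into three classes of pairwise vertex-disjoint edges. -/
theorem exists_three_colouring {U : Type*} (M : Finset (U × U)) (hM : IsMatching M) :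
    ∃ col : U × U → Fin 3, ∀ e ∈ M, ∀ f ∈ M, e ≠ f → col e = col f →
      e.1 ≠ f.1 ∧ e.1 ≠ f.2 ∧ e.2 ≠ f.1 ∧ e.2 ≠ f.2 := by
  classical
  induction M using Finset.induction_on with
  | empty => exact ⟨fun _ => 0, by simp⟩
  | insert e M he ih =>
    obtain ⟨col, hcol⟩ := ih fun f hf g hg =>
      hM f (Finset.mem_insert_of_mem hf) g (Finset.mem_insert_of_mem hg)
    have hone : ∀ f ∈ insert e M, ∀ g ∈ insert e M, f.1 = g.1 ∨ f.2 = g.2 → f = g := by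
      intro f hf g hg h
      by_contra hne
      exact hM f hf g hg ⟨hne, h⟩
    -- Within a matching, `e` can only touch the one edge ending at its source and the one starting
    -- at its target, so a third colour is free.
    have hex : ∃ c : Fin 3, ∀ f ∈ M, (f.2 = e.1 ∨ f.1 = e.2) → col f ≠ c := by
      have h1 : ∃ a : Fin 3, ∀ f ∈ M, f.2 = e.1 → col f = a := by
        by_cases h : ∃ f ∈ M, f.2 = e.1
        · obtain ⟨f, hf, hfe⟩ := h
          refine ⟨col f, fun g hg hge => ?_⟩
          rw [hone g (Finset.mem_insert_of_mem hg) f (Finset.mem_insert_of_mem hf)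
            (Or.inr (hge.trans hfe.symm))]
        · exact ⟨0, fun f hf hfe => (h ⟨f, hf, hfe⟩).elim⟩
      have h2 : ∃ a : Fin 3, ∀ f ∈ M, f.1 = e.2 → col f = a := by
        by_cases h : ∃ f ∈ M, f.1 = e.2
        · obtain ⟨f, hf, hfe⟩ := h
          refine ⟨col f, fun g hg hge => ?_⟩
          rw [hone g (Finset.mem_insert_of_mem hg) f (Finset.mem_insert_of_mem hf)
            (Or.inl (hge.trans hfe.symm))]
        · exact ⟨0, fun f hf hfe => (h ⟨f, hf, hfe⟩).elim⟩
      obtain ⟨a, ha⟩ := h1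
      obtain ⟨a', ha'⟩ := h2
      obtain ⟨c, hc, hc'⟩ : ∃ c : Fin 3, a ≠ c ∧ a' ≠ c := by
        fin_cases a <;> fin_cases a' <;> first
          | exact ⟨0, by decide⟩ | exact ⟨1, by decide⟩ | exact ⟨2, by decide⟩
      exact ⟨c, fun f hf h => h.elim (fun h => ha f hf h ▸ hc) fun h => ha' f hf h ▸ hc'⟩
    obtain ⟨c, hc⟩ := hex
    have key : ∀ f ∈ M, c = col f →
        e.1 ≠ f.1 ∧ e.1 ≠ f.2 ∧ e.2 ≠ f.1 ∧ e.2 ≠ f.2 := by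
      intro f hf hcf
      have hne : e ≠ f := fun h => he (h ▸ hf)
      refine ⟨fun h => ?_, fun h => hc f hf (Or.inl h.symm) hcf.symm,
        fun h => hc f hf (Or.inr h.symm) hcf.symm, fun h => ?_⟩
      · exact hne (hone e (Finset.mem_insert_self _ _) f (Finset.mem_insert_of_mem hf) (Or.inl h))
      · exact hne (hone e (Finset.mem_insert_self _ _) f (Finset.mem_insert_of_mem hf) (Or.inr h))
    refine ⟨Function.update col e c, fun f hf g hg hfg h => ?_⟩
    rcases Finset.mem_insert.1 hf with rfl | hf' <;> rcases Finset.mem_insert.1 hg with rfl | hg'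
    · exact (hfg rfl).elim
    · rw [Function.update_self, Function.update_of_ne hfg.symm] at h
      exact key g hg' h
    · rw [Function.update_self, Function.update_of_ne hfg] at h
      have := key f hf' h.symm
      exact ⟨this.1.symm, this.2.2.1.symm, this.2.1.symm, this.2.2.2.symm⟩
    · rw [Function.update_of_ne (fun h : f = e => he (h ▸ hf')),
        Function.update_of_ne (fun h : g = e => he (h ▸ hg'))] at h
      exact hcol f hf' g hg' hfg h

/-- The number of heads is at most twice the square of the number of vertices. -/
theorem numHeads_le (G : Digraph V) {d : ℕ} (hd : 1 ≤ d) :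
    numHeads G d ≤ 2 * Fintype.card V ^ 2 := by
  classical
  have h1 : numEdges G ≤ Fintype.card V ^ 2 := by
    have := Finset.card_le_univ (edges G)
    simpa [numEdges, sq] using this
  have h2 : maxDegree G ≤ Fintype.card V ^ 2 := by
    have hdeg : maxDegree G ≤ Fintype.card V := by
      refine max_le (Finset.sup_le fun v _ => ?_) (Finset.sup_le fun v _ => ?_)
      · exact Finset.card_le_univ _
      · exact Finset.card_le_univ _
    nlinarith [Nat.zero_le (maxDegree G), Nat.le_self_pow two_ne_zero (Fintype.card V)]
  have h3 : ⌈(numEdges G : ℝ) / d⌉₊ ≤ numEdges G := by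
    refine Nat.ceil_le.2 (div_le_self (Nat.cast_nonneg _) ?_)
    exact_mod_cast hd
  unfold numHeads
  omega

/-- The number of heads is at most `2 (m' / d + Δ)`. -/
theorem numHeads_le_two_mul (G : Digraph V) {d : ℕ} :
    (numHeads G d : ℝ) ≤ 2 * ((numEdges G : ℝ) / d + maxDegree G) := by
  classical
  have h0 : (0 : ℝ) ≤ (numEdges G : ℝ) / d := by positivity
  rcases (edges G).eq_empty_or_nonempty with h | ⟨e, he⟩
  · have : numEdges G = 0 := by simp [numEdges, h]
    simp only [numHeads, this]
    simp
    linarith [(Nat.cast_nonneg (maxDegree G) : (0 : ℝ) ≤ _)]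
  · have hadj : G.Adj e.1 e.2 := by simpa [edges] using he
    -- One edge already forces `Δ ≥ 1`, which absorbs the loss of the ceiling.
    have hΔ : 1 ≤ maxDegree G := by
      refine le_trans ?_ ((Finset.le_sup (f := outDegree G) (Finset.mem_univ e.1)).trans
        (le_max_left _ _))
      exact Finset.card_pos.2 ⟨e.2, by simpa using hadj⟩
    have hΔ' : (1 : ℝ) ≤ maxDegree G := by exact_mod_cast hΔ
    have := Nat.ceil_lt_add_one h0
    simp only [numHeads]
    push_cast
    linarith

end EdgeColouring

/-! ### Conditioning and independence in finite product measures -/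

section ProductMeasure

variable {ι α : Type*} [MeasurableSpace α]

theorem measurable_piecewise [DecidableEq ι] (J : Finset ι) :
    Measurable fun p : (ι → α) × (ι → α) => J.piecewise p.1 p.2 := by
  refine measurable_pi_lambda _ fun i => ?_
  by_cases h : i ∈ J
  · simp only [Finset.piecewise, h, if_true]; fun_prop
  · simp only [Finset.piecewise, h, if_false]; fun_prop

variable [Fintype ι]

/-- Resampling some of the coordinates does not change a product measure. -/
theorem measurePreserving_piecewise [DecidableEq ι] (μ : ι → Measure α) [∀ i, IsProbabilityMeasure (μ i)]
    (J : Finset ι) :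
    MeasurePreserving (fun p : (ι → α) × (ι → α) => J.piecewise p.1 p.2)
      ((Measure.pi μ).prod (Measure.pi μ)) (Measure.pi μ) := by
  refine ⟨measurable_piecewise J, (Measure.pi_eq fun s hs => ?_).symm⟩
  rw [Measure.map_apply (measurable_piecewise J) (MeasurableSet.univ_pi hs)]
  have : (fun p : (ι → α) × (ι → α) => J.piecewise p.1 p.2) ⁻¹' Set.univ.pi s =
      (Set.univ.pi fun i => if i ∈ J then s i else Set.univ) ×ˢ
        (Set.univ.pi fun i => if i ∈ J then Set.univ else s i) := by
    ext p
    simp only [Set.mem_preimage, Set.mem_univ_pi, Set.mem_prod, ← forall_and]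
    refine forall_congr' fun i => ?_
    by_cases h : i ∈ J <;> simp [h, Finset.piecewise]
  rw [this, Measure.prod_prod, Measure.pi_pi, Measure.pi_pi, ← Finset.prod_mul_distrib]
  refine Finset.prod_congr rfl fun i _ => ?_
  by_cases h : i ∈ J <;> simp [h]

/-- Substitute for conditional expectation: the coordinates in `J` are frozen at `x`, the others
averaged over an independent copy `y`. -/
theorem lintegral_pi_piecewise [DecidableEq ι] (μ : ι → Measure α) [∀ i, IsProbabilityMeasure (μ i)]
    (J : Finset ι) {F : (ι → α) → ℝ≥0∞} (hF : Measurable F) :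
    ∫⁻ x, F x ∂Measure.pi μ =
      ∫⁻ x, ∫⁻ y, F (J.piecewise x y) ∂Measure.pi μ ∂Measure.pi μ := by
  rw [← (measurePreserving_piecewise μ J).lintegral_comp hF,
    lintegral_prod (fun p : (ι → α) × (ι → α) => F (J.piecewise p.1 p.2))
      (hF.comp (measurable_piecewise J)).aemeasurable]

/-- A bound for the integral over the coordinates outside `J`, valid for almost all values of the
coordinates in `J`, is a bound for the whole integral. -/
theorem lintegral_pi_le_of_ae_piecewise [DecidableEq ι] (μ : ι → Measure α) [∀ i, IsProbabilityMeasure (μ i)]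
    (J : Finset ι) {F : (ι → α) → ℝ≥0∞} (hF : Measurable F) {B : ℝ≥0∞}
    (h : ∀ᵐ x ∂Measure.pi μ, ∫⁻ y, F (J.piecewise x y) ∂Measure.pi μ ≤ B) :
    ∫⁻ x, F x ∂Measure.pi μ ≤ B := by
  rw [lintegral_pi_piecewise μ J hF]
  exact (lintegral_mono_ae h).trans (by simp)

theorem lintegral_pi_mul [DecidableEq ι] (μ : ι → Measure α) [∀ i, IsProbabilityMeasure (μ i)]
    (J : Finset ι) {f g : (ι → α) → ℝ≥0∞} (hf : Measurable f) (hg : Measurable g)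
    (hfJ : DependsOn f J) (hgJ : DependsOn g (J : Set ι)ᶜ) :
    ∫⁻ x, f x * g x ∂Measure.pi μ = (∫⁻ x, f x ∂Measure.pi μ) * ∫⁻ x, g x ∂Measure.pi μ := by
  rw [lintegral_pi_piecewise μ J (F := fun x => f x * g x) (hf.mul hg)]
  have : ∀ x y, f (J.piecewise x y) * g (J.piecewise x y) = f x * g y := by
    intro x y
    congr 1
    · exact hfJ fun i hi => Finset.piecewise_eq_of_mem _ _ _ hi
    · exact hgJ fun i hi => Finset.piecewise_eq_of_notMem _ _ _ hi
  simp_rw [this]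
  simp_rw [lintegral_const_mul _ hg]
  rw [lintegral_mul_const _ hf]

/-- Functions of disjoint blocks of coordinates are independent. -/
theorem lintegral_pi_prod [DecidableEq ι] {κ : Type*} (μ : ι → Measure α) [∀ i, IsProbabilityMeasure (μ i)]
    (N : Finset κ) (J : κ → Finset ι) (f : κ → (ι → α) → ℝ≥0∞) (hf : ∀ e ∈ N, Measurable (f e))
    (hfJ : ∀ e ∈ N, DependsOn (f e) (J e))
    (hJ : ∀ e ∈ N, ∀ e' ∈ N, e ≠ e' → Disjoint (J e) (J e')) :
    ∫⁻ x, ∏ e ∈ N, f e x ∂Measure.pi μ = ∏ e ∈ N, ∫⁻ x, f e x ∂Measure.pi μ := by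
  classical
  induction N using Finset.induction_on with
  | empty => simp
  | insert e N he ih =>
    simp_rw [Finset.prod_insert he]
    rw [lintegral_pi_mul μ (J e) (hf e (Finset.mem_insert_self _ _))
      (Finset.measurable_fun_prod _ fun e' h => hf e' (Finset.mem_insert_of_mem h))
      (hfJ e (Finset.mem_insert_self _ _)), ih]
    · exact fun e' h => hf e' (Finset.mem_insert_of_mem h)
    · exact fun e' h => hfJ e' (Finset.mem_insert_of_mem h)
    · exact fun e' h e'' h' => hJ e' (Finset.mem_insert_of_mem h) e'' (Finset.mem_insert_of_mem h')
    · intro x y hxy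
      refine Finset.prod_congr rfl fun e' h => ?_
      refine hfJ e' (Finset.mem_insert_of_mem h) fun i hi => hxy i ?_
      have hd := hJ e (Finset.mem_insert_self _ _) e' (Finset.mem_insert_of_mem h)
        (fun h' => he (h' ▸ h))
      exact fun hi' => Finset.disjoint_left.1 hd hi' hi

theorem lintegral_pi_eval (μ : ι → Measure α) [∀ i, IsProbabilityMeasure (μ i)] (i : ι)
    {f : α → ℝ≥0∞} (hf : Measurable f) :
    ∫⁻ x, f (x i) ∂Measure.pi μ = ∫⁻ y, f y ∂μ i :=
  (measurePreserving_eval μ i).lintegral_comp hf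

end ProductMeasure

/-! ### Chernoff bounds, sub-exponential and sub-Gaussian variables -/

section ExponentialMoments

/-- The exponential function with values in `ℝ≥0∞`. -/
noncomputable def eexp (x : ℝ) : ℝ≥0∞ := ENNReal.ofReal (Real.exp x)

@[fun_prop]
theorem measurable_eexp : Measurable eexp := by unfold eexp; fun_prop

theorem eexp_mono {x y : ℝ} (h : x ≤ y) : eexp x ≤ eexp y :=
  ENNReal.ofReal_le_ofReal (Real.exp_le_exp.2 h)

theorem eexp_add (x y : ℝ) : eexp (x + y) = eexp x * eexp y := by
  rw [eexp, Real.exp_add, ENNReal.ofReal_mul (Real.exp_nonneg x)]; rfl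

theorem eexp_zero : eexp 0 = 1 := by simp [eexp]

theorem eexp_sum {κ : Type*} (N : Finset κ) (f : κ → ℝ) :
    eexp (∑ e ∈ N, f e) = ∏ e ∈ N, eexp (f e) := by
  rw [eexp, Real.exp_sum, ENNReal.ofReal_prod_of_nonneg fun _ _ => Real.exp_nonneg _]; rfl

theorem eexp_pow (x : ℝ) (n : ℕ) : eexp x ^ n = eexp (n * x) := by
  rw [eexp, eexp, Real.exp_nat_mul, ENNReal.ofReal_pow (Real.exp_nonneg x)]

variable {Ω : Type*} [MeasurableSpace Ω] {μ : Measure Ω}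

/-- The exponential Markov inequality. -/
theorem measure_ge_le_eexp {f : Ω → ℝ} (hf : AEMeasurable f μ) {l : ℝ} (hl : 0 ≤ l) (t : ℝ) :
    μ {x | t ≤ f x} ≤ eexp (-(l * t)) * ∫⁻ x, eexp (l * f x) ∂μ := by
  have h1 : μ {x | t ≤ f x} ≤ μ {x | eexp (l * t) ≤ eexp (l * f x)} :=
    measure_mono fun x hx => eexp_mono (mul_le_mul_of_nonneg_left hx hl)
  have h2 := mul_meas_ge_le_lintegral₀ (μ := μ) (f := fun x => eexp (l * f x))
    (measurable_eexp.comp_aemeasurable (hf.const_mul l)) (eexp (l * t))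
  calc μ {x | t ≤ f x} = eexp (-(l * t)) * (eexp (l * t) * μ {x | t ≤ f x}) := by
        rw [← mul_assoc, ← eexp_add, neg_add_cancel, eexp_zero, one_mul]
    _ ≤ _ := by
        gcongr
        exact (mul_le_mul_right h1 _).trans h2

theorem exp_le_one_add_add (x : ℝ) : Real.exp x ≤ 1 + x + x ^ 2 * Real.exp |x| := by
  have h := Complex.norm_exp_sub_sum_le_norm_mul_exp (x : ℂ) 2
  simp only [Finset.sum_range_succ, Finset.sum_range_zero] at h
  norm_num at h
  have h2 : Complex.exp x - (1 + x) = ((Real.exp x - (1 + x) : ℝ) : ℂ) := by push_cast; ring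
  rw [h2, Complex.norm_real, Real.norm_eq_abs] at h
  linarith [le_abs_self (Real.exp x - (1 + x))]

/-- The second-order remainder carries only `exp (|z| / 2)`; the other half of `exp |z|` pays for `z
^ 2`. Integrated, this turns one exponential moment into a quadratic bound on the log-moment
function. -/
theorem exp_mul_le_of_abs_le_half {l z : ℝ} (hl : |l| ≤ 1 / 2) :
    Real.exp (l * z) ≤ 1 + l * z + 8 * l ^ 2 * Real.exp |z| := by
  have h1 := exp_le_one_add_add (l * z)
  have h2 : |l * z| ≤ |z| / 2 := by
    rw [abs_mul]
    nlinarith [abs_nonneg z]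
  have h3 : z ^ 2 ≤ 8 * Real.exp (|z| / 2) := by
    have := Real.quadratic_le_exp_of_nonneg (x := |z| / 2) (by positivity)
    nlinarith [abs_nonneg z, sq_abs z]
  have h4 : Real.exp |z| = Real.exp (|z| / 2) * Real.exp (|z| / 2) := by
    rw [← Real.exp_add, add_halves]
  have h5 : (l * z) ^ 2 * Real.exp |l * z| ≤ 8 * l ^ 2 * Real.exp |z| := by
    calc (l * z) ^ 2 * Real.exp |l * z| ≤ (l ^ 2 * (8 * Real.exp (|z| / 2))) *
          Real.exp (|z| / 2) := by
          rw [mul_pow]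
          gcongr
      _ = _ := by rw [h4]; ring
  linarith

/-- A random variable with an exponential moment is sub-exponential. -/
theorem lintegral_eexp_mul_le [IsProbabilityMeasure μ] {Z : Ω → ℝ} (hZ : AEMeasurable Z μ)
    {B : ℝ} (hB : ∫⁻ x, eexp |Z x| ∂μ ≤ ENNReal.ofReal B) {l : ℝ} (hl : |l| ≤ 1 / 2) :
    ∫⁻ x, eexp (l * Z x) ∂μ ≤ eexp (l * ∫ x, Z x ∂μ + 8 * l ^ 2 * B) := by
  have hi : Integrable (fun x => Real.exp |Z x|) μ := by
    refine ⟨(Real.measurable_exp.comp_aemeasurable hZ.abs).aestronglyMeasurable, ?_⟩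
    rw [hasFiniteIntegral_iff_ofReal (Filter.Eventually.of_forall fun x => (Real.exp_nonneg _))]
    exact hB.trans_lt ENNReal.ofReal_lt_top
  have hiZ : Integrable Z μ := by
    refine hi.mono' hZ.aestronglyMeasurable (Filter.Eventually.of_forall fun x => ?_)
    rw [Real.norm_eq_abs]
    linarith [Real.add_one_le_exp |Z x|]
  have hil : Integrable (fun x => Real.exp (l * Z x)) μ := by
    refine hi.mono' (Real.measurable_exp.comp_aemeasurable (hZ.const_mul l)).aestronglyMeasurable
      (Filter.Eventually.of_forall fun x => ?_)
    rw [Real.norm_eq_abs, Real.abs_exp, Real.exp_le_exp]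
    refine (le_abs_self _).trans ?_
    rw [abs_mul]
    nlinarith [abs_nonneg (Z x)]
  -- `ENNReal.ofReal` would truncate a negative `B` to `0`, but a positive function has positive
  -- integral under a probability measure.
  have hB0 : 0 ≤ B := by
    by_contra h
    rw [ENNReal.ofReal_of_nonpos (not_le.1 h).le, nonpos_iff_eq_zero] at hB
    replace hB :=
      (lintegral_eq_zero_iff' (f := fun x => eexp |Z x|) (by fun_prop)).1 hB
    have : ∀ᵐ x ∂μ, False := by
      filter_upwards [hB] with x hx
      simp only [eexp, Pi.zero_apply, ENNReal.ofReal_eq_zero] at hx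
      linarith [Real.exp_pos |Z x|]
    exact IsProbabilityMeasure.ne_zero μ (by simpa using this)
  have hBr : ∫ x, Real.exp |Z x| ∂μ ≤ B := by
    rw [← ENNReal.ofReal_le_ofReal_iff hB0, ofReal_integral_eq_lintegral_ofReal hi
      (Filter.Eventually.of_forall fun x => (Real.exp_nonneg _))]
    exact hB
  unfold eexp
  rw [← ofReal_integral_eq_lintegral_ofReal hil
      (Filter.Eventually.of_forall fun x => (Real.exp_nonneg _))]
  refine ENNReal.ofReal_le_ofReal ?_
  calc ∫ x, Real.exp (l * Z x) ∂μ ≤ ∫ x, (1 + l * Z x + 8 * l ^ 2 * Real.exp |Z x|) ∂μ := by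
        refine integral_mono hil ?_ fun x => exp_mul_le_of_abs_le_half hl
        exact ((integrable_const _).add (hiZ.const_mul l)).add (hi.const_mul _)
    _ = 1 + l * ∫ x, Z x ∂μ + 8 * l ^ 2 * ∫ x, Real.exp |Z x| ∂μ := by
        rw [integral_add (f := fun x => 1 + l * Z x)
            ((integrable_const _).add (hiZ.const_mul l)) (hi.const_mul _),
          integral_add (integrable_const _) (hiZ.const_mul l), integral_const_mul,
          integral_const_mul]
        simp
    _ ≤ (l * ∫ x, Z x ∂μ + 8 * l ^ 2 * B) + 1 := by
        have := mul_le_mul_of_nonneg_left hBr (by positivity : 0 ≤ 8 * l ^ 2)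
        linarith
    _ ≤ _ := Real.add_one_le_exp _

/-- The exponential moments of the square of a centred Gaussian. -/
theorem lintegral_eexp_sq_gaussianReal {v : ℝ≥0} (hv : v ≠ 0) {l : ℝ} (hl : 2 * l * v < 1) :
    ∫⁻ y, eexp (l * y ^ 2) ∂gaussianReal 0 v = ENNReal.ofReal (1 / Real.sqrt (1 - 2 * l * v)) := by
  set w : ℝ := 1 - 2 * l * v with hw
  have hw0 : 0 < w := by linarith
  have hv0 : (0 : ℝ) < v := by positivity
  -- The tilted density is `1 / √w` times the Gaussian density of variance `v / w`.
  let v' : ℝ≥0 := v / ⟨w, hw0.le⟩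
  have hv' : (v' : ℝ) = v / w := rfl
  have hv'0 : v' ≠ 0 := by
    rw [← NNReal.coe_ne_zero, hv']
    positivity
  rw [gaussianReal_of_var_ne_zero _ hv, lintegral_withDensity_eq_lintegral_mul _
    (measurable_gaussianPDF _ _) (by fun_prop)]
  have : ∀ y : ℝ, (gaussianPDF 0 v * fun y => eexp (l * y ^ 2)) y =
      ENNReal.ofReal (1 / Real.sqrt w) * gaussianPDF 0 v' y := by
    intro y
    simp only [Pi.mul_apply, gaussianPDF, eexp]
    rw [← ENNReal.ofReal_mul (gaussianPDFReal_nonneg _ _ _), ← ENNReal.ofReal_mul (by positivity)]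
    congr 1
    simp only [gaussianPDFReal, hv']
    rw [mul_assoc, ← Real.exp_add, ← mul_assoc]
    congr 1
    · have : 2 * Real.pi * (v : ℝ) = w * (2 * Real.pi * (v / w)) := by field_simp
      rw [this, Real.sqrt_mul hw0.le, mul_inv, one_div]
    · congr 1
      field_simp
      rw [hw]
      ring
  simp_rw [this]
  rw [lintegral_const_mul _ (measurable_gaussianPDF _ _), lintegral_gaussianPDF_eq_one _ hv'0,
    mul_one]

theorem lintegral_eexp_mul_gaussianReal (v : ℝ≥0) (t : ℝ) :
    ∫⁻ y, eexp (t * y) ∂gaussianReal 0 v = eexp (v * t ^ 2 / 2) := by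
  have h := mgf_gaussianReal (p := gaussianReal 0 v) (X := id) (μ := 0) (v := v)
    Measure.map_id t
  unfold eexp
  rw [← ofReal_integral_eq_lintegral_ofReal (integrable_exp_mul_gaussianReal t)
    (Filter.Eventually.of_forall fun x => (Real.exp_nonneg _))]
  simp only [mgf, id, zero_mul, zero_add] at h
  rw [h]

/-- A sub-Gaussian random variable has a square with an exponential moment. -/
theorem lintegral_eexp_sq_le [SFinite μ] {p : Ω → ℝ} (hp : Measurable p) {s : ℝ} (hs : 0 < s)
    (h : ∀ t, ∫⁻ x, eexp (t * p x) ∂μ ≤ eexp (s * t ^ 2 / 2)) :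
    ∫⁻ x, eexp (p x ^ 2 / (4 * s)) ∂μ ≤ ENNReal.ofReal (Real.sqrt 2) := by
  -- Gaussian linearization: `exp (p ^ 2 / (4 * s))` is the mean of `exp (p * y)` for `y` of this
  -- variance. After exchanging the integrals, a Gaussian square with `2 * (s / 2) * v = 1 / 2`
  -- remains, whence `√2`.
  let v : ℝ≥0 := ⟨1 / (2 * s), by positivity⟩
  have hv : (v : ℝ) = 1 / (2 * s) := rfl
  have hv0 : v ≠ 0 := by rw [← NNReal.coe_ne_zero, hv]; positivity
  calc ∫⁻ x, eexp (p x ^ 2 / (4 * s)) ∂μ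
      = ∫⁻ x, ∫⁻ y, eexp (p x * y) ∂gaussianReal 0 v ∂μ := by
        refine lintegral_congr fun x => ?_
        rw [lintegral_eexp_mul_gaussianReal, hv]
        congr 1
        field_simp
        ring
    _ = ∫⁻ y, ∫⁻ x, eexp (y * p x) ∂μ ∂gaussianReal 0 v := by
        rw [lintegral_lintegral_swap (by fun_prop)]
        simp_rw [mul_comm]
    _ ≤ ∫⁻ y, eexp (s / 2 * y ^ 2) ∂gaussianReal 0 v := by
        refine lintegral_mono fun y => (h y).trans (eexp_mono (le_of_eq (by ring)))
    _ = ENNReal.ofReal (Real.sqrt 2) := by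
        have h1 : 2 * (s / 2) * (v : ℝ) = 1 / 2 := by rw [hv]; field_simp
        rw [lintegral_eexp_sq_gaussianReal hv0 (by rw [h1]; norm_num), h1]
        congr 1
        rw [show (1 - 1 / 2 : ℝ) = 2⁻¹ by norm_num, Real.sqrt_inv]
        simp

/-- Linear forms in independent sub-Gaussian variables are sub-Gaussian. -/
theorem lintegral_eexp_linear_le {ι : Type*} [Fintype ι] {ν : Measure ℝ} [IsProbabilityMeasure ν]
    {s : ℝ} (h : ∀ t, ∫⁻ x, eexp (t * x) ∂ν ≤ eexp (s * t ^ 2 / 2)) (u : ι → ℝ) (t : ℝ) :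
    ∫⁻ y, eexp (t * ∑ b, u b * y b) ∂(Measure.pi fun _ : ι => ν) ≤
      eexp (s * (∑ b, u b ^ 2) * t ^ 2 / 2) := by
  classical
  have hexp : ∀ y : ι → ℝ, eexp (t * ∑ b, u b * y b) = ∏ b, eexp (t * (u b * y b)) := by
    intro y
    rw [Finset.mul_sum, eexp_sum]
  simp_rw [hexp]
  rw [lintegral_pi_prod (fun _ => ν) Finset.univ (fun b => {b})
    (fun b y => eexp (t * (u b * y b))) (fun b _ => by fun_prop)
    (fun b _ x y hxy => by simp only [hxy b (by simp)])
    (fun b _ b' _ hb => by simpa using hb)]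
  rw [show s * (∑ b, u b ^ 2) * t ^ 2 / 2 = ∑ b, s * (t * u b) ^ 2 / 2 by
    rw [Finset.mul_sum, Finset.sum_mul, Finset.sum_div]
    exact Finset.sum_congr rfl fun b _ => by ring, eexp_sum]
  refine Finset.prod_le_prod' fun b _ => ?_
  rw [lintegral_pi_eval (fun _ => ν) b (f := fun y => eexp (t * (u b * y))) (by fun_prop)]
  simp_rw [← mul_assoc]
  exact h _

theorem lintegral_eexp_linear_sq_le {ι : Type*} [Fintype ι] {ν : Measure ℝ}
    [IsProbabilityMeasure ν] {s L : ℝ} (hs : 0 < s) (hL : 0 < L)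
    (h : ∀ t, ∫⁻ x, eexp (t * x) ∂ν ≤ eexp (s * t ^ 2 / 2)) (u : ι → ℝ) (hu : ∑ b, u b ^ 2 ≤ L) :
    ∫⁻ y, eexp ((∑ b, u b * y b) ^ 2 / (4 * (s * L))) ∂(Measure.pi fun _ : ι => ν) ≤
      ENNReal.ofReal (Real.sqrt 2) := by
  refine lintegral_eexp_sq_le (by fun_prop) (by positivity) fun t => ?_
  refine (lintegral_eexp_linear_le h u t).trans (eexp_mono ?_)
  gcongr

/-- An exponential moment of a product is bounded by exponential moments of the squares. -/
theorem lintegral_eexp_abs_mul_le {p q : Ω → ℝ} (hp : AEMeasurable p μ) {a b B : ℝ}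
    (ha : 0 ≤ a) (hb : 0 ≤ b) (hB : 0 ≤ B)
    (h1 : ∫⁻ x, eexp (a * p x ^ 2) ∂μ ≤ ENNReal.ofReal B)
    (h2 : ∫⁻ x, eexp (a * q x ^ 2) ∂μ ≤ ENNReal.ofReal B) (hab : b ≤ a) :
    ∫⁻ x, eexp |b * (p x * q x)| ∂μ ≤ ENNReal.ofReal (2 * B) := by
  calc ∫⁻ x, eexp |b * (p x * q x)| ∂μ
      ≤ ∫⁻ x, (eexp (a * p x ^ 2) + eexp (a * q x ^ 2)) ∂μ := by
        refine lintegral_mono fun x => ?_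
        -- Bounding by the larger square, and the exponential of a maximum by a sum, needs no
        -- independence of `p` and `q`.
        have key : |b * (p x * q x)| ≤ max (a * p x ^ 2) (a * q x ^ 2) := by
          rw [abs_mul, abs_of_nonneg hb, abs_mul, ← sq_abs (p x), ← sq_abs (q x)]
          rcases le_total |p x| |q x| with h | h
          · refine le_max_of_le_right ?_
            have : |p x| * |q x| ≤ |q x| ^ 2 := by nlinarith [abs_nonneg (q x)]
            exact mul_le_mul hab this (by positivity) ha
          · refine le_max_of_le_left ?_
            have : |p x| * |q x| ≤ |p x| ^ 2 := by nlinarith [abs_nonneg (p x)]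
            exact mul_le_mul hab this (by positivity) ha
        refine (eexp_mono key).trans ?_
        rcases max_cases (a * p x ^ 2) (a * q x ^ 2) with h | h <;> rw [h.1]
        · exact le_self_add
        · exact le_add_self
    _ = ∫⁻ x, eexp (a * p x ^ 2) ∂μ + ∫⁻ x, eexp (a * q x ^ 2) ∂μ :=
        lintegral_add_left' (by fun_prop) _
    _ ≤ ENNReal.ofReal B + ENNReal.ofReal B := add_le_add h1 h2
    _ = ENNReal.ofReal (2 * B) := by rw [← ENNReal.ofReal_add hB hB, two_mul]

end ExponentialMoments

/-! ### Linear forms of a normalized Gaussian vector -/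

section RowLaw

/-- Rescale a vector to Euclidean norm one. -/
noncomputable def normalizeRow {d : ℕ} (y : Fin d → ℝ) : Fin d → ℝ :=
  fun a => y a / Real.sqrt (∑ b, y b ^ 2)

/-- The law of a normalized standard Gaussian vector. -/
noncomputable def rowLaw (d : ℕ) : Measure (Fin d → ℝ) :=
  (Measure.pi fun _ => gaussianReal 0 ((d : ℝ≥0)⁻¹)).map normalizeRow

variable {d : ℕ}

@[fun_prop]
theorem measurable_normalizeRow : Measurable (normalizeRow (d := d)) := by
  unfold normalizeRow
  fun_prop

instance : IsProbabilityMeasure (rowLaw d) :=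
  Measure.isProbabilityMeasure_map measurable_normalizeRow.aemeasurable

theorem map_normalizeRows (V : Type*) [Fintype V] (d : ℕ) :
    (gaussianMatrix V d).map normalizeRows = Measure.pi fun _ : V => rowLaw d :=
  have : ∀ _ : V, SigmaFinite
      ((Measure.pi fun _ : Fin d => gaussianReal 0 ((d : ℝ≥0)⁻¹)).map normalizeRow) :=
    fun _ => inferInstanceAs (SigmaFinite (rowLaw d))
  Measure.pi_map_pi (f := fun _ : V => normalizeRow (d := d))
    fun _ => measurable_normalizeRow.aemeasurable

/-- Normalization fails only at the zero vector, which is avoided as soon as one coordinate is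
nonzero, an almost sure event. -/
theorem ae_rowLaw_dotProduct_self (hd : 1 ≤ d) : ∀ᵐ x ∂rowLaw d, x ⬝ᵥ x = 1 := by
  rw [rowLaw, ae_map_iff measurable_normalizeRow.aemeasurable
    (measurableSet_eq_fun (by simp only [dotProduct]; fun_prop) measurable_const)]
  have h0 : ((d : ℝ≥0)⁻¹) ≠ 0 := by
    have : (d : ℝ≥0) ≠ 0 := Nat.cast_ne_zero.2 (by omega)
    exact inv_ne_zero this
  have : NullSingletonClass (gaussianReal 0 ((d : ℝ≥0)⁻¹)) :=
    nullSingletonClass_gaussianReal h0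
  have hne : ∀ᵐ y ∂(Measure.pi fun _ : Fin d => gaussianReal 0 ((d : ℝ≥0)⁻¹)),
      y ⟨0, hd⟩ ≠ 0 :=
    (measurePreserving_eval (fun _ : Fin d => gaussianReal 0 ((d : ℝ≥0)⁻¹))
      ⟨0, hd⟩).quasiMeasurePreserving.ae (p := fun t => t ≠ 0) (Measure.ae_ne _ 0)
  filter_upwards [hne] with y hy
  have hpos : 0 < ∑ b, y b ^ 2 :=
    lt_of_lt_of_le (by positivity : 0 < y ⟨0, hd⟩ ^ 2)
      (Finset.single_le_sum (f := fun b => y b ^ 2) (fun b _ => sq_nonneg _) (Finset.mem_univ _))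
  simp only [dotProduct, normalizeRow, ← sq, div_pow, Real.sq_sqrt hpos.le, ← Finset.sum_div]
  exact div_self hpos.ne'

/-- The Gaussian law is symmetric and normalization is odd. This symmetry is what centres the linear
forms. -/
theorem measurePreserving_neg_rowLaw : MeasurePreserving (fun x => -x) (rowLaw d) (rowLaw d) := by
  have hg : MeasurePreserving (fun y : Fin d → ℝ => -y)
      (Measure.pi fun _ => gaussianReal 0 ((d : ℝ≥0)⁻¹))
      (Measure.pi fun _ => gaussianReal 0 ((d : ℝ≥0)⁻¹)) :=
    measurePreserving_pi _ _ (f := fun _ t => -t)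
      fun _ => ⟨measurable_neg, by rw [gaussianReal_map_neg, neg_zero]⟩
  refine ⟨measurable_neg, ?_⟩
  rw [rowLaw, Measure.map_map measurable_neg measurable_normalizeRow]
  conv_rhs => rw [← hg.map_eq, Measure.map_map measurable_normalizeRow hg.measurable]
  congr 1
  ext y a
  simp [normalizeRow, neg_div]

theorem integral_dotProduct_rowLaw (e : Fin d → ℝ) : ∫ x, e ⬝ᵥ x ∂rowLaw d = 0 := by
  have h := (measurePreserving_neg_rowLaw (d := d)).integral_comp
    (MeasurableEquiv.neg (Fin d → ℝ)).measurableEmbedding fun x => e ⬝ᵥ x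
  simp only [dotProduct_neg, integral_neg] at h
  linarith

/-- Controls short Gaussian vectors. Each coordinate contributes `exp (21 / 40) / √3 ≤ 1`; the split
`21 / 40 = 1 / 2 + 1 / 40` leaves an exponent of at least `d / 40` when the squared norm is below `1
/ 2`. -/
theorem lintegral_eexp_neg_sq_gaussian_le (hd : 1 ≤ d) :
    ∫⁻ y, eexp (d * (21 / 40) - ∑ b, d * y b ^ 2)
      ∂(Measure.pi fun _ : Fin d => gaussianReal 0 ((d : ℝ≥0)⁻¹)) ≤ 1 := by
  have hd0 : (d : ℝ) ≠ 0 := by positivity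
  have h0 : ((d : ℝ≥0)⁻¹) ≠ 0 := by
    have : (d : ℝ≥0) ≠ 0 := Nat.cast_ne_zero.2 (by omega)
    exact inv_ne_zero this
  have hexp : ∀ y : Fin d → ℝ, eexp (d * (21 / 40) - ∑ b, d * y b ^ 2) =
      ∏ b, (eexp (21 / 40) * eexp (-d * y b ^ 2)) := by
    intro y
    rw [Finset.prod_mul_distrib, ← eexp_sum, ← eexp_sum, ← eexp_add]
    congr 1
    simp [sub_eq_add_neg]
  simp_rw [hexp]
  rw [lintegral_pi_prod (fun _ => gaussianReal 0 ((d : ℝ≥0)⁻¹)) Finset.univ (fun b => {b})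
    (fun b y => eexp (21 / 40) * eexp (-d * y b ^ 2)) (fun b _ => by fun_prop)
    (fun b _ x y hxy => by simp only [hxy b (by simp)])
    (fun b _ b' _ hb => by simpa using hb)]
  refine Finset.prod_le_one' fun b _ => ?_
  rw [lintegral_pi_eval (fun _ => gaussianReal 0 ((d : ℝ≥0)⁻¹)) b
    (f := fun y => eexp (21 / 40) * eexp (-d * y ^ 2)) (by fun_prop),
    lintegral_const_mul _ (by fun_prop)]
  have h3 : 1 - 2 * (-(d : ℝ)) * ((d : ℝ≥0)⁻¹ : ℝ≥0) = 3 := by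
    push_cast
    field_simp
    norm_num
  rw [lintegral_eexp_sq_gaussianReal h0 (by linarith), h3, eexp,
    ← ENNReal.ofReal_mul (Real.exp_nonneg _), ← ENNReal.ofReal_one]
  refine ENNReal.ofReal_le_ofReal ?_
  rw [mul_one_div, div_le_one (by positivity)]
  refine Real.le_sqrt_of_sq_le ?_
  rw [← Real.exp_nat_mul]
  have h4 : Real.exp (1 / 20) ≤ 1 / (1 - 1 / 20) := by
    have h5 := Real.add_one_le_exp (-(1 / 20 : ℝ))
    have h6 : Real.exp (1 / 20) * Real.exp (-(1 / 20)) = 1 := by rw [← Real.exp_add]; simp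
    rw [le_div_iff₀ (by norm_num)]
    nlinarith [Real.exp_pos (1 / 20 : ℝ)]
  calc Real.exp ((2 : ℕ) * (21 / 40)) = Real.exp 1 * Real.exp (1 / 20) := by
        rw [← Real.exp_add]; norm_num
    _ ≤ 2.7182818286 * (1 / (1 - 1 / 20)) :=
        mul_le_mul Real.exp_one_lt_d9.le h4 (Real.exp_nonneg _) (by norm_num)
    _ ≤ 3 := by norm_num

/-- Squared linear forms of a uniform unit vector have an exponential moment at scale `1 / d`. -/
theorem lintegral_eexp_sq_rowLaw_le (hd : 1 ≤ d) {e : Fin d → ℝ} (he : e ⬝ᵥ e ≤ 1) :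
    ∫⁻ x, eexp (d / 40 * (e ⬝ᵥ x) ^ 2) ∂rowLaw d ≤ ENNReal.ofReal 3 := by
  have hd0 : (0 : ℝ) < d := by positivity
  have he' : ∑ b, e b ^ 2 ≤ 1 := by simpa [dotProduct, sq] using he
  have hmeas : Measurable fun x : Fin d → ℝ => e ⬝ᵥ x := by
    simp only [dotProduct]; fun_prop
  rw [rowLaw, lintegral_map (by fun_prop) measurable_normalizeRow]
  -- If `‖y‖² ≥ 1 / 2`, normalizing costs a factor at most `2` and the Gaussian form dominates.
  -- Otherwise Cauchy–Schwarz bounds the exponent by `d / 40`, which the short-vector term pays.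
  have hpt : ∀ y : Fin d → ℝ, eexp (d / 40 * (e ⬝ᵥ normalizeRow y) ^ 2) ≤
      eexp ((∑ b, e b * y b) ^ 2 / (4 * ((d : ℝ)⁻¹ * 1))) +
        eexp (d * (21 / 40) - ∑ b, d * y b ^ 2) := by
    intro y
    set r := ∑ b, y b ^ 2 with hr
    set g := ∑ b, e b * y b with hg
    have hr0 : 0 ≤ r := Finset.sum_nonneg fun b _ => sq_nonneg _
    have hgr : (e ⬝ᵥ normalizeRow y) ^ 2 = g ^ 2 / r := by
      simp only [dotProduct, normalizeRow, ← mul_div_assoc, ← Finset.sum_div, div_pow]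
      rw [Real.sq_sqrt hr0]
    have hcs : g ^ 2 ≤ r := by
      refine (Finset.sum_mul_sq_le_sq_mul_sq _ _ _).trans ?_
      exact mul_le_of_le_one_left hr0 he'
    rw [hgr, ← Finset.mul_sum, ← hr]
    rcases le_or_gt (1 / 2) r with h | h
    · refine le_trans (eexp_mono ?_) le_self_add
      have : g ^ 2 / r ≤ 2 * g ^ 2 := by
        rw [div_le_iff₀ (by linarith)]
        nlinarith [sq_nonneg g]
      have h2 : g ^ 2 / (4 * ((d : ℝ)⁻¹ * 1)) = d / 4 * g ^ 2 := by field_simp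
      rw [h2]
      nlinarith [sq_nonneg g]
    · refine le_trans (eexp_mono ?_) le_add_self
      have : g ^ 2 / r ≤ 1 := div_le_one_of_le₀ hcs hr0
      nlinarith
  refine (lintegral_mono hpt).trans ?_
  rw [lintegral_add_left (by fun_prop)]
  have h1 := lintegral_eexp_linear_sq_le (ν := gaussianReal 0 ((d : ℝ≥0)⁻¹)) (s := (d : ℝ)⁻¹)
    (L := 1) (by positivity) one_pos
    (fun t => (lintegral_eexp_mul_gaussianReal _ t).trans_le (by push_cast; rfl)) e he'
  refine (add_le_add h1 (lintegral_eexp_neg_sq_gaussian_le hd)).trans ?_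
  rw [← ENNReal.ofReal_one, ← ENNReal.ofReal_add (Real.sqrt_nonneg _) zero_le_one]
  refine ENNReal.ofReal_le_ofReal ?_
  have : Real.sqrt 2 ≤ 2 := Real.sqrt_le_iff.2 ⟨by norm_num, by norm_num⟩
  linarith

end RowLaw

/-! ### Tail bounds for the Gram matrix of the embedding -/

section GramTails

variable {V : Type*} [Fintype V] {d : ℕ}

@[fun_prop]
theorem measurable_dotProduct {Ω : Type*} [MeasurableSpace Ω] {f g : Ω → Fin d → ℝ}
    (hf : Measurable f) (hg : Measurable g) : Measurable fun x => f x ⬝ᵥ g x := by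
  simp only [dotProduct]
  fun_prop

theorem ae_pi_rowLaw (hd : 1 ≤ d) :
    ∀ᵐ X ∂(Measure.pi fun _ : V => rowLaw d), ∀ a, X a ⬝ᵥ X a = 1 :=
  ae_all_iff.2 fun a =>
    (measurePreserving_eval (fun _ : V => rowLaw d) a).quasiMeasurePreserving.ae
      (ae_rowLaw_dotProduct_self hd)

theorem lintegral_eexp_sq_pi_rowLaw_le (hd : 1 ≤ d) {e : Fin d → ℝ} (he : e ⬝ᵥ e ≤ 1) (a : V) :
    ∫⁻ X, eexp (d / 40 * (e ⬝ᵥ X a) ^ 2) ∂(Measure.pi fun _ : V => rowLaw d) ≤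
      ENNReal.ofReal 3 := by
  rw [lintegral_pi_eval (fun _ : V => rowLaw d) a
    (f := fun x => eexp (d / 40 * (e ⬝ᵥ x) ^ 2)) (by fun_prop)]
  exact lintegral_eexp_sq_rowLaw_le hd he

theorem integral_dotProduct_mul_dotProduct (e f : Fin d → ℝ) {a b : V} (hab : a ≠ b) :
    ∫ X, (e ⬝ᵥ X a) * (f ⬝ᵥ X b) ∂(Measure.pi fun _ : V => rowLaw d) = 0 := by
  have hind := (iIndepFun_pi (μ := fun _ : V => rowLaw d) (X := fun _ x => x)
    fun _ => aemeasurable_id).indepFun hab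
  have hind2 := hind.comp (φ := fun x => e ⬝ᵥ x) (ψ := fun x => f ⬝ᵥ x)
    (by fun_prop) (by fun_prop)
  have := hind2.integral_fun_mul_eq_mul_integral
    (Measurable.aestronglyMeasurable (by fun_prop)) (Measurable.aestronglyMeasurable (by fun_prop))
  simp only [Function.comp_def] at this
  rw [this]
  have h0 : ∫ X : V → Fin d → ℝ, e ⬝ᵥ X a ∂(Measure.pi fun _ : V => rowLaw d) = 0 := by
    rw [← integral_dotProduct_rowLaw e]
    exact integral_comp_eval (μ := fun _ : V => rowLaw d) (i := a) (f := fun x => e ⬝ᵥ x)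
      (Measurable.aestronglyMeasurable (by fun_prop))
  rw [h0, zero_mul]

/-- Independence of the two rows serves only to make the mean vanish, leaving the quadratic term `8
* (2 * 3) * l ^ 2`. -/
theorem lintegral_eexp_pair_le (hd : 1 ≤ d) {e f : Fin d → ℝ} (he : e ⬝ᵥ e ≤ 1)
    (hf : f ⬝ᵥ f ≤ 1) {a b : V} (hab : a ≠ b) {l : ℝ} (hl : |l| ≤ 1 / 2) :
    ∫⁻ X, eexp (l * (d / 40 * ((e ⬝ᵥ X a) * (f ⬝ᵥ X b))))
      ∂(Measure.pi fun _ : V => rowLaw d) ≤ eexp (48 * l ^ 2) := by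
  have h := lintegral_eexp_mul_le (μ := Measure.pi fun _ : V => rowLaw d)
    (Z := fun X => d / 40 * ((e ⬝ᵥ X a) * (f ⬝ᵥ X b)))
    (Measurable.aemeasurable (by fun_prop)) (B := 2 * 3)
    (lintegral_eexp_abs_mul_le (Measurable.aemeasurable (by fun_prop)) (by positivity)
      (by positivity) (by norm_num) (lintegral_eexp_sq_pi_rowLaw_le hd he a)
      (lintegral_eexp_sq_pi_rowLaw_le hd hf b) le_rfl) hl
  rw [integral_const_mul, integral_dotProduct_mul_dotProduct e f hab] at h
  exact h.trans (eexp_mono (le_of_eq (by ring)))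

/-- Different rows are almost orthogonal. -/
theorem measure_abs_dotProduct_ge_le (hd : 1 ≤ d) {a b : V} (hab : a ≠ b) :
    (Measure.pi fun _ : V => rowLaw d) {X | 1 / 32 ≤ |X a ⬝ᵥ X b|} ≤
      3 * eexp (-(1 / 40960 * d)) := by
  classical
  have hsub : {X : V → Fin d → ℝ | 1 / 32 ≤ |X a ⬝ᵥ X b|} ⊆
      {X | 1 / 1024 ≤ (X a ⬝ᵥ X b) ^ 2} := by
    intro X hX
    simp only [Set.mem_ofPred_eq] at hX ⊢
    rw [← sq_abs]
    nlinarith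
  refine (measure_mono hsub).trans ((measure_ge_le_eexp (Measurable.aemeasurable (by fun_prop))
    (l := d / 40) (by positivity) _).trans ?_)
  rw [mul_comm]
  refine mul_le_mul' ?_ (eexp_mono (le_of_eq (by ring)))
  -- With row `a` frozen, the inner product is a linear form of row `b` along a unit vector.
  refine lintegral_pi_le_of_ae_piecewise (fun _ : V => rowLaw d) {a} (by fun_prop) ?_
  filter_upwards [ae_pi_rowLaw (V := V) hd] with x hx
  have hb : b ∉ ({a} : Finset V) := by simpa using hab.symm
  simp only [Finset.piecewise_eq_of_mem _ _ _ (Finset.mem_singleton_self a),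
    Finset.piecewise_eq_of_notMem _ _ _ hb]
  simpa using lintegral_eexp_sq_pi_rowLaw_le hd (hx a).le b

/-- A row has bounded correlation with any `d` other rows. -/
theorem measure_sum_sq_dotProduct_ge_le (hd : 1 ≤ d) {i : V} {A : Finset V} (hi : i ∉ A)
    (hA : A.card ≤ d) :
    (Measure.pi fun _ : V => rowLaw d) {X | 100 ≤ ∑ a ∈ A, (X i ⬝ᵥ X a) ^ 2} ≤ eexp (-d) := by
  classical
  refine (measure_ge_le_eexp (Measurable.aemeasurable (by fun_prop))
    (l := d / 40) (by positivity) _).trans ?_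
  -- At most `d` rows then cost `exp (3 * d / 2)`, against the Markov gain `exp (-(d / 40) * 100)`;
  -- `exp (-d)` remains.
  have h3 : (3 : ℝ≥0∞) ≤ eexp (3 / 2) := by
    rw [eexp, show (3 : ℝ≥0∞) = ENNReal.ofReal 3 by simp]
    refine ENNReal.ofReal_le_ofReal ?_
    have := Real.quadratic_le_exp_of_nonneg (x := 3 / 2) (by norm_num)
    linarith
  have hint : ∫⁻ X : V → Fin d → ℝ, eexp (d / 40 * ∑ a ∈ A, (X i ⬝ᵥ X a) ^ 2)
      ∂(Measure.pi fun _ : V => rowLaw d) ≤ eexp (d * (3 / 2)) := by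
    refine lintegral_pi_le_of_ae_piecewise (fun _ : V => rowLaw d) {i} (by fun_prop) ?_
    filter_upwards [ae_pi_rowLaw (V := V) hd] with x hx
    have hexp : ∀ y : V → Fin d → ℝ,
        eexp (d / 40 * ∑ a ∈ A, (Finset.piecewise {i} x y i ⬝ᵥ Finset.piecewise {i} x y a) ^ 2) =
          ∏ a ∈ A, eexp (d / 40 * (x i ⬝ᵥ y a) ^ 2) := by
      intro y
      rw [← eexp_sum, ← Finset.mul_sum, Finset.piecewise_eq_of_mem _ _ _ (Finset.mem_singleton_self i)]
      congr 2
      refine Finset.sum_congr rfl fun a ha => ?_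
      rw [Finset.piecewise_eq_of_notMem]
      rw [Finset.mem_singleton]
      rintro rfl
      exact hi ha
    simp_rw [hexp]
    rw [lintegral_pi_prod (fun _ : V => rowLaw d) A (fun a => {a})
      (fun a y => eexp (d / 40 * (x i ⬝ᵥ y a) ^ 2)) (fun a _ => by fun_prop)
      (fun a _ x y hxy => by simp only [hxy a (by simp)])
      (fun a _ b _ hab => by simpa using hab)]
    calc ∏ a ∈ A, ∫⁻ y : V → Fin d → ℝ, eexp (d / 40 * (x i ⬝ᵥ y a) ^ 2)
          ∂(Measure.pi fun _ : V => rowLaw d) ≤ ∏ a ∈ A, eexp (3 / 2) := by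
          refine Finset.prod_le_prod' fun a _ =>
            (lintegral_eexp_sq_pi_rowLaw_le hd (hx i).le a).trans ?_
          simpa using h3
      _ = eexp (A.card * (3 / 2)) := by rw [Finset.prod_const, eexp_pow]
      _ ≤ _ := eexp_mono (by gcongr)
  refine (mul_le_mul_right hint _).trans ?_
  rw [← eexp_add]
  exact eexp_mono (le_of_eq (by ring))

/-- Correlations of two rows along vertex-disjoint edges that avoid them average out. -/
theorem lintegral_eexp_disjoint_edges_le (hd : 1 ≤ d) (i j : V) {N : Finset (V × V)}
    (hN : N.card ≤ d) (hne : ∀ e ∈ N, e.1 ≠ e.2)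
    (havoid : ∀ e ∈ N, e.1 ≠ i ∧ e.1 ≠ j ∧ e.2 ≠ i ∧ e.2 ≠ j)
    (hdisj : ∀ e ∈ N, ∀ f ∈ N, e ≠ f → e.1 ≠ f.1 ∧ e.1 ≠ f.2 ∧ e.2 ≠ f.1 ∧ e.2 ≠ f.2)
    {l : ℝ} (hl : |l| ≤ 1 / 2) :
    ∫⁻ X : V → Fin d → ℝ, eexp (l * (d / 40 * ∑ e ∈ N, (X i ⬝ᵥ X e.1) * (X j ⬝ᵥ X e.2)))
      ∂(Measure.pi fun _ : V => rowLaw d) ≤ eexp (d * (48 * l ^ 2)) := by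
  classical
  -- Once rows `i` and `j` are frozen, each edge depends on its own pair of rows, so the exponential
  -- factors over edges.
  refine lintegral_pi_le_of_ae_piecewise (fun _ : V => rowLaw d) {i, j} (by fun_prop) ?_
  filter_upwards [ae_pi_rowLaw (V := V) hd] with x hx
  have hexp : ∀ y : V → Fin d → ℝ,
      eexp (l * (d / 40 * ∑ e ∈ N,
        (Finset.piecewise {i, j} x y i ⬝ᵥ Finset.piecewise {i, j} x y e.1) *
          (Finset.piecewise {i, j} x y j ⬝ᵥ Finset.piecewise {i, j} x y e.2))) =
        ∏ e ∈ N, eexp (l * (d / 40 * ((x i ⬝ᵥ y e.1) * (x j ⬝ᵥ y e.2)))) := by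
    intro y
    rw [← eexp_sum, ← Finset.mul_sum, ← Finset.mul_sum,
      Finset.piecewise_eq_of_mem (i := i) _ _ _ (by simp),
      Finset.piecewise_eq_of_mem (i := j) _ _ _ (by simp)]
    congr 3
    refine Finset.sum_congr rfl fun e he => ?_
    obtain ⟨h1, h2, h3, h4⟩ := havoid e he
    rw [Finset.piecewise_eq_of_notMem _ _ _ (by simp [h1, h2]),
      Finset.piecewise_eq_of_notMem _ _ _ (by simp [h3, h4])]
  simp_rw [hexp]
  rw [lintegral_pi_prod (fun _ : V => rowLaw d) N (fun e => {e.1, e.2})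
    (fun e y => eexp (l * (d / 40 * ((x i ⬝ᵥ y e.1) * (x j ⬝ᵥ y e.2)))))
    (fun e _ => by fun_prop)
    (fun e _ x y hxy => by simp only [hxy e.1 (by simp), hxy e.2 (by simp)])
    (fun e he f hf hef => by
      obtain ⟨h1, h2, h3, h4⟩ := hdisj e he f hf hef
      rw [Finset.disjoint_left]
      intro a ha hb
      simp only [Finset.mem_insert, Finset.mem_singleton] at ha hb
      rcases ha with rfl | rfl <;> rcases hb with hb | hb
      · exact h1 hb
      · exact h2 hb
      · exact h3 hb
      · exact h4 hb)]
  calc ∏ e ∈ N, ∫⁻ y : V → Fin d → ℝ, eexp (l * (d / 40 * ((x i ⬝ᵥ y e.1) * (x j ⬝ᵥ y e.2))))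
        ∂(Measure.pi fun _ : V => rowLaw d) ≤ ∏ e ∈ N, eexp (48 * l ^ 2) :=
        Finset.prod_le_prod' fun e he =>
          lintegral_eexp_pair_le hd (hx i).le (hx j).le (hne e he) hl
    _ = eexp (N.card * (48 * l ^ 2)) := by rw [Finset.prod_const, eexp_pow]
    _ ≤ _ := eexp_mono (by gcongr)

/-- Chernoff for both signs. Per dimension the exponent is `48 * l ^ 2 - l / 960`, minimal at `l = 1
/ 92160` with value `-1 / 176947200`. -/
theorem measure_abs_sum_disjoint_edges_ge_le (hd : 1 ≤ d) (i j : V) {N : Finset (V × V)}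
    (hN : N.card ≤ d) (hne : ∀ e ∈ N, e.1 ≠ e.2)
    (havoid : ∀ e ∈ N, e.1 ≠ i ∧ e.1 ≠ j ∧ e.2 ≠ i ∧ e.2 ≠ j)
    (hdisj : ∀ e ∈ N, ∀ f ∈ N, e ≠ f → e.1 ≠ f.1 ∧ e.1 ≠ f.2 ∧ e.2 ≠ f.1 ∧ e.2 ≠ f.2) :
    (Measure.pi fun _ : V => rowLaw d)
      {X | 1 / 24 ≤ |∑ e ∈ N, (X i ⬝ᵥ X e.1) * (X j ⬝ᵥ X e.2)|} ≤
        2 * eexp (-(1 / 176947200 * d)) := by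
  set F : (V → Fin d → ℝ) → ℝ := fun X => ∑ e ∈ N, (X i ⬝ᵥ X e.1) * (X j ⬝ᵥ X e.2) with hF
  have hFm : Measurable F := by fun_prop
  have key : ∀ s : ℝ, |s| = 1 → (Measure.pi fun _ : V => rowLaw d) {X | 1 / 24 ≤ s * F X} ≤
      eexp (-(1 / 176947200 * d)) := by
    intro s hs
    refine (measure_ge_le_eexp (Measurable.aemeasurable (by fun_prop))
      (l := d / 40 / 92160) (by positivity) _).trans ?_
    have h := lintegral_eexp_disjoint_edges_le hd i j hN hne havoid hdisj (l := s / 92160)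
      (by rw [abs_div, hs]; norm_num [abs_of_pos])
    have h2 : ∫⁻ X, eexp (d / 40 / 92160 * (s * F X)) ∂(Measure.pi fun _ : V => rowLaw d) ≤
        eexp (d * (48 * (s / 92160) ^ 2)) := by
      refine le_trans (le_of_eq (lintegral_congr fun X => ?_)) h
      congr 1
      simp only [hF]
      ring
    refine (mul_le_mul_right h2 _).trans ?_
    rw [← eexp_add]
    refine eexp_mono (le_of_eq ?_)
    have : s ^ 2 = 1 := by rw [← sq_abs, hs]; norm_num
    rw [div_pow, this]
    ring
  have hsub : {X | 1 / 24 ≤ |F X|} ⊆ {X | 1 / 24 ≤ 1 * F X} ∪ {X | 1 / 24 ≤ -1 * F X} := by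
    intro X hX
    simp only [Set.mem_ofPred_eq, Set.mem_union, one_mul, neg_one_mul] at hX ⊢
    exact le_abs.1 hX
  refine (measure_mono hsub).trans ((measure_union_le _ _).trans ?_)
  rw [two_mul]
  exact add_le_add (key 1 (by simp)) (key (-1) (by simp))

end GramTails

/-! ### Transposition, which turns signature columns into independent blocks -/

section Transpose

variable {ι κ α : Type*} [Fintype ι] [Fintype κ] [MeasurableSpace α]

theorem pi_pi_eq_map_curry (ν : Measure α) [IsProbabilityMeasure ν] :
    (Measure.pi fun _ : ι => Measure.pi fun _ : κ => ν) =
      (Measure.pi fun _ : ι × κ => ν).map (MeasurableEquiv.curry ι κ α) := by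
  simp_rw [← Measure.infinitePi_eq_pi]
  exact (Measure.infinitePi_map_curry fun (_ : ι) (_ : κ) => ν).symm

/-- The law of a matrix with independent identically distributed entries is invariant under
transposition. -/
theorem measurePreserving_flip (ν : Measure α) [IsProbabilityMeasure ν] :
    MeasurePreserving (fun (W : ι → κ → α) c b => W b c)
      (Measure.pi fun _ : ι => Measure.pi fun _ : κ => ν)
      (Measure.pi fun _ : κ => Measure.pi fun _ : ι => ν) := by
  have hT : Measurable fun (W : ι → κ → α) (c : κ) (b : ι) => W b c := by fun_prop
  have hS : Measurable fun (x : ι × κ → α) (p : κ × ι) => x p.swap := by fun_prop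
  have hswap : (Measure.pi fun _ : ι × κ => ν).map (fun x (p : κ × ι) => x p.swap) =
      Measure.pi fun _ : κ × ι => ν := by
    refine (Measure.pi_eq fun s hs => ?_).symm
    rw [Measure.map_apply hS (MeasurableSet.univ_pi hs)]
    have : (fun (x : ι × κ → α) (p : κ × ι) => x p.swap) ⁻¹' Set.univ.pi s =
        Set.univ.pi fun p : ι × κ => s p.swap := by
      ext x
      simp only [Set.mem_preimage, Set.mem_univ_pi]
      exact ⟨fun h p => h p.swap, fun h p => h p.swap⟩
    rw [this, Measure.pi_pi]
    exact (Equiv.prodComm ι κ).prod_comp fun p => ν (s p)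
  refine ⟨hT, ?_⟩
  rw [pi_pi_eq_map_curry, pi_pi_eq_map_curry, ← hswap,
    Measure.map_map hT (MeasurableEquiv.measurable _),
    Measure.map_map (MeasurableEquiv.measurable _) hS]
  rfl

end Transpose

/-! ### Concentration of bilinear forms in random signs -/

section SignatureTails

instance : IsProbabilityMeasure rademacher := by
  constructor
  simp only [rademacher, Measure.coe_add, Pi.add_apply, Measure.smul_apply, measure_univ,
    smul_eq_mul, mul_one]
  exact ENNReal.inv_two_add_inv_two

theorem integrable_rademacher (f : ℝ → ℝ) : Integrable f rademacher :=
  ((integrable_dirac (by simp)).smul_measure (by simp)).add_measure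
    ((integrable_dirac (by simp)).smul_measure (by simp))

theorem integral_rademacher (f : ℝ → ℝ) : ∫ x, f x ∂rademacher = (f 1 + f (-1)) / 2 := by
  rw [rademacher, integral_add_measure ((integrable_dirac (by simp)).smul_measure (by simp))
    ((integrable_dirac (by simp)).smul_measure (by simp)), integral_smul_measure,
    integral_smul_measure, integral_dirac, integral_dirac]
  simp
  ring

theorem lintegral_eexp_rademacher_le (t : ℝ) :
    ∫⁻ x, eexp (t * x) ∂rademacher ≤ eexp (1 * t ^ 2 / 2) := by
  unfold eexp
  rw [← ofReal_integral_eq_lintegral_ofReal (integrable_rademacher _)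
    (Filter.Eventually.of_forall fun x => Real.exp_nonneg _), integral_rademacher]
  refine ENNReal.ofReal_le_ofReal ?_
  have := Real.cosh_le_exp_half_sq t
  rw [Real.cosh_eq] at this
  simpa using this

variable {V : Type*} [Fintype V]

theorem integrable_mul_rademacher (b b' : V) :
    Integrable (fun y : V → ℝ => y b * y b') (Measure.pi fun _ : V => rademacher) := by
  by_cases h : b = b'
  · subst h
    exact integrable_comp_eval (μ := fun _ : V => rademacher) (i := b) (f := fun x : ℝ => x * x)
      (integrable_rademacher _)
  · have hind := (iIndepFun_pi (μ := fun _ : V => rademacher) (X := fun _ x => x)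
      fun _ => aemeasurable_id).indepFun h
    exact hind.integrable_mul
      (integrable_comp_eval (μ := fun _ : V => rademacher) (f := fun x : ℝ => x)
        (integrable_rademacher _))
      (integrable_comp_eval (μ := fun _ : V => rademacher) (f := fun x : ℝ => x)
        (integrable_rademacher _))

theorem integral_mul_rademacher [DecidableEq V] (b b' : V) :
    ∫ y : V → ℝ, y b * y b' ∂(Measure.pi fun _ : V => rademacher) = if b = b' then 1 else 0 := by
  split_ifs with h
  · subst h
    rw [integral_comp_eval (μ := fun _ : V => rademacher) (i := b) (f := fun x : ℝ => x * x)
      (integrable_rademacher _).aestronglyMeasurable, integral_rademacher]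
    norm_num
  · have hind := (iIndepFun_pi (μ := fun _ : V => rademacher) (X := fun _ x => x)
      fun _ => aemeasurable_id).indepFun h
    rw [hind.integral_fun_mul_eq_mul_integral (Measurable.aestronglyMeasurable (by fun_prop))
      (Measurable.aestronglyMeasurable (by fun_prop)),
      integral_comp_eval (μ := fun _ : V => rademacher) (i := b) (f := fun x : ℝ => x)
      (integrable_rademacher _).aestronglyMeasurable, integral_rademacher]
    simp

/-- The covariance of two linear forms in independent signs. -/
theorem integral_linear_mul_linear (u v : V → ℝ) :
    ∫ y : V → ℝ, (∑ b, u b * y b) * (∑ b, v b * y b) ∂(Measure.pi fun _ : V => rademacher) =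
      ∑ b, u b * v b := by
  classical
  have h : ∀ y : V → ℝ, (∑ b, u b * y b) * (∑ b, v b * y b) =
      ∑ b, ∑ b', (u b * v b') * (y b * y b') := by
    intro y
    rw [Finset.sum_mul_sum]
    exact Finset.sum_congr rfl fun b _ => Finset.sum_congr rfl fun b' _ => by ring
  simp_rw [h]
  rw [integral_finsetSum _ fun b _ => integrable_finsetSum _ fun b' _ =>
    (integrable_mul_rademacher b b').const_mul _]
  refine Finset.sum_congr rfl fun b _ => ?_
  rw [integral_finsetSum _ fun b' _ => (integrable_mul_rademacher b b').const_mul _]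
  simp_rw [integral_const_mul, integral_mul_rademacher]
  simp

/-- One signature column. Scaling by `1 / (4 * L)` gives both squared forms an exponential moment at
most `2`, hence `32 = 8 * (2 * 2)`; the two forms may be dependent. -/
theorem lintegral_eexp_linear_mul_linear_le {L : ℝ} (hL : 0 < L) {u v : V → ℝ}
    (hu : ∑ b, u b ^ 2 ≤ L) (hv : ∑ b, v b ^ 2 ≤ L) {l : ℝ} (hl : |l| ≤ 1 / 2) :
    ∫⁻ y : V → ℝ, eexp (l * (1 / (4 * L) * ((∑ b, u b * y b) * ∑ b, v b * y b)))
      ∂(Measure.pi fun _ : V => rademacher) ≤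
        eexp (l * (1 / (4 * L) * ∑ b, u b * v b) + 32 * l ^ 2) := by
  have hsq : ∀ w : V → ℝ, ∑ b, w b ^ 2 ≤ L →
      ∫⁻ y : V → ℝ, eexp (1 / (4 * L) * (∑ b, w b * y b) ^ 2)
        ∂(Measure.pi fun _ : V => rademacher) ≤ ENNReal.ofReal 2 := by
    intro w hw
    have := lintegral_eexp_linear_sq_le one_pos hL lintegral_eexp_rademacher_le w hw
    simp only [one_mul] at this
    simp_rw [one_div, inv_mul_eq_div]
    refine this.trans (ENNReal.ofReal_le_ofReal ?_)
    exact Real.sqrt_le_iff.2 ⟨by norm_num, by norm_num⟩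
  have h := lintegral_eexp_mul_le (μ := Measure.pi fun _ : V => rademacher)
    (Z := fun y => 1 / (4 * L) * ((∑ b, u b * y b) * ∑ b, v b * y b))
    (Measurable.aemeasurable (by fun_prop)) (B := 2 * 2)
    (lintegral_eexp_abs_mul_le (Measurable.aemeasurable (by fun_prop)) (by positivity)
      (by positivity) (by norm_num) (hsq u hu) (hsq v hv) le_rfl) hl
  rw [integral_const_mul, integral_linear_mul_linear] at h
  exact h.trans (eexp_mono (le_of_eq (by ring)))

instance (dk : ℕ) : IsProbabilityMeasure (rademacherMatrix V dk) := by
  unfold rademacherMatrix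
  infer_instance

/-- Concentration of the bilinear form of a random sign matrix. -/
theorem measure_abs_bilinear_ge_le (dk : ℕ) {u v : V → ℝ}
    (hu : ∑ b, u b ^ 2 ≤ 101) (hv : ∑ b, v b ^ 2 ≤ 101) :
    rademacherMatrix V dk {W | (dk : ℝ) / 8 ≤
      |∑ c, (∑ b, u b * W b c) * (∑ b, v b * W b c) - dk * ∑ b, u b * v b|} ≤
        2 * eexp (-(1 / 1337065472 * dk)) := by
  classical
  set F : (V → Fin dk → ℝ) → ℝ := fun W =>
    ∑ c, (∑ b, u b * W b c) * (∑ b, v b * W b c) with hF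
  set m : ℝ := ∑ b, u b * v b with hm
  have hFm : Measurable F := by fun_prop
  have hmgf : ∀ l : ℝ, |l| ≤ 1 / 2 → ∫⁻ W, eexp (l * (1 / (4 * 101) * F W))
      ∂rademacherMatrix V dk ≤ eexp (dk * (l * (1 / (4 * 101) * m) + 32 * l ^ 2)) := by
    intro l hl
    let g (y : V → ℝ) : ℝ≥0∞ :=
      eexp (l * (1 / (4 * 101) * ((∑ b, u b * y b) * ∑ b, v b * y b)))
    have hg : Measurable g := by
      simp only [g]
      fun_prop
    have h1 : ∫⁻ W, eexp (l * (1 / (4 * 101) * F W)) ∂rademacherMatrix V dk =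
        ∫⁻ W' : Fin dk → V → ℝ, ∏ c, g (W' c)
          ∂(Measure.pi fun _ : Fin dk => Measure.pi fun _ : V => rademacher) := by
      rw [rademacherMatrix, ← (measurePreserving_flip (ι := V) (κ := Fin dk)
        rademacher).lintegral_comp (Finset.measurable_fun_prod _ fun c _ => by fun_prop)]
      refine lintegral_congr fun W => ?_
      simp only [g, hF]
      rw [← eexp_sum, Finset.mul_sum, Finset.mul_sum]
    rw [h1, lintegral_pi_prod (fun _ : Fin dk => Measure.pi fun _ : V => rademacher) Finset.univ
      (fun c => {c}) (fun c y => g (y c)) (fun c _ => by fun_prop)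
      (fun c _ x y hxy => by simp only [hxy c (by simp)])
      (fun c _ c' _ hc => by simpa using hc)]
    calc ∏ c, ∫⁻ y, g (y c) ∂(Measure.pi fun _ : Fin dk => Measure.pi fun _ : V => rademacher)
        ≤ ∏ _c : Fin dk, eexp (l * (1 / (4 * 101) * m) + 32 * l ^ 2) := by
          refine Finset.prod_le_prod' fun c _ => ?_
          rw [lintegral_pi_eval (fun _ : Fin dk => Measure.pi fun _ : V => rademacher) c hg]
          exact lintegral_eexp_linear_mul_linear_le (by norm_num) hu hv hl
      _ = _ := by rw [Finset.prod_const, eexp_pow, Finset.card_univ, Fintype.card_fin]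
  -- Per column the exponent is `32 * l ^ 2 - l / 3232`, where `3232 = 8 * 4 * 101`. It is minimal
  -- at `l = 1 / 206848`, with value `-1 / 1337065472`.
  have key : ∀ s : ℝ, |s| = 1 → rademacherMatrix V dk {W | (dk : ℝ) / 8 ≤ s * (F W - dk * m)} ≤
      eexp (-(1 / 1337065472 * dk)) := by
    intro s hs
    refine (measure_ge_le_eexp (Measurable.aemeasurable (by fun_prop))
      (l := 1 / (4 * 101) / 206848) (by positivity) _).trans ?_
    have h := hmgf (s / 206848) (by rw [abs_div, hs]; norm_num [abs_of_pos])
    have h2 : ∫⁻ W, eexp (1 / (4 * 101) / 206848 * (s * (F W - dk * m))) ∂rademacherMatrix V dk ≤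
        eexp (-(1 / (4 * 101) / 206848 * (s * (dk * m)))) *
          eexp (dk * (s / 206848 * (1 / (4 * 101) * m) + 32 * (s / 206848) ^ 2)) := by
      refine le_trans (le_of_eq ?_) (mul_le_mul_right h _)
      rw [← lintegral_const_mul _ (by fun_prop)]
      refine lintegral_congr fun W => ?_
      rw [← eexp_add]
      congr 1
      ring
    refine (mul_le_mul_right h2 _).trans ?_
    rw [← eexp_add, ← eexp_add]
    refine eexp_mono (le_of_eq ?_)
    have : s ^ 2 = 1 := by rw [← sq_abs, hs]; norm_num
    rw [div_pow, this]
    ring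
  have hsub : {W | (dk : ℝ) / 8 ≤ |F W - dk * m|} ⊆
      {W | (dk : ℝ) / 8 ≤ 1 * (F W - dk * m)} ∪ {W | (dk : ℝ) / 8 ≤ -1 * (F W - dk * m)} := by
    intro W hW
    simp only [Set.mem_ofPred_eq, Set.mem_union, one_mul, neg_one_mul] at hW ⊢
    exact le_abs.1 hW
  refine (measure_mono hsub).trans ((measure_union_le _ _).trans ?_)
  rw [two_mul]
  exact add_le_add (key 1 (by simp)) (key (-1) (by simp))

end SignatureTails

/-! ### From Gram estimates to the indicator of a matching -/

section MatchingSums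

variable {V : Type*}

theorem IsMatching.eq_of_fst {M : Finset (V × V)} (hM : IsMatching M) {e f : V × V}
    (he : e ∈ M) (hf : f ∈ M) (h : e.1 = f.1) : e = f := by
  by_contra hne
  exact hM e he f hf ⟨hne, Or.inl h⟩

theorem IsMatching.eq_of_snd {M : Finset (V × V)} (hM : IsMatching M) {e f : V × V}
    (he : e ∈ M) (hf : f ∈ M) (h : e.2 = f.2) : e = f := by
  by_contra hne
  exact hM e he f hf ⟨hne, Or.inr h⟩

/-- Each of `i` and `j` is the source of at most one edge and the target of at most one. -/
theorem IsMatching.card_incident_le [DecidableEq V] {M : Finset (V × V)} (hM : IsMatching M)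
    (i j : V) :
    (M.filter fun e => ¬ (e.1 ≠ i ∧ e.1 ≠ j ∧ e.2 ≠ i ∧ e.2 ≠ j)).card ≤ 4 := by
  have h1 : ∀ a, (M.filter fun e => e.1 = a).card ≤ 1 := fun a =>
    Finset.card_le_one.2 fun e he f hf => by
      rw [Finset.mem_filter] at he hf
      exact hM.eq_of_fst he.1 hf.1 (he.2.trans hf.2.symm)
  have h2 : ∀ a, (M.filter fun e => e.2 = a).card ≤ 1 := fun a =>
    Finset.card_le_one.2 fun e he f hf => by
      rw [Finset.mem_filter] at he hf
      exact hM.eq_of_snd he.1 hf.1 (he.2.trans hf.2.symm)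
  have hsub : (M.filter fun e => ¬ (e.1 ≠ i ∧ e.1 ≠ j ∧ e.2 ≠ i ∧ e.2 ≠ j)) ⊆
      ((M.filter fun e => e.1 = i) ∪ (M.filter fun e => e.1 = j)) ∪
        ((M.filter fun e => e.2 = i) ∪ (M.filter fun e => e.2 = j)) := by
    intro e he
    simp only [Finset.mem_filter, Finset.mem_union] at he ⊢
    tauto
  refine (Finset.card_le_card hsub).trans ((Finset.card_union_le _ _).trans ?_)
  have := Finset.card_union_le (M.filter fun e => e.1 = i) (M.filter fun e => e.1 = j)
  have := Finset.card_union_le (M.filter fun e => e.2 = i) (M.filter fun e => e.2 = j)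
  have := h1 i
  have := h1 j
  have := h2 i
  have := h2 j
  omega

/-- For an almost orthonormal Gram matrix, the correlation of two rows along a matching is close
to the indicator of the edge between them, if it is small along the edges that avoid them. -/
theorem abs_sum_matching_sub_le [DecidableEq V] {M : Finset (V × V)} (hM : IsMatching M) (i j : V)
    (g : V → V → ℝ) (hg1 : ∀ a, g a a = 1) (hg2 : ∀ a b, a ≠ b → |g a b| ≤ 1 / 32)
    (col : V × V → Fin 3)
    (hg3 : ∀ c, |∑ e ∈ (M.filter fun e => e.1 ≠ i ∧ e.1 ≠ j ∧ e.2 ≠ i ∧ e.2 ≠ j).filter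
      fun e => col e = c, g i e.1 * g j e.2| ≤ 1 / 24) :
    |∑ e ∈ M, g i e.1 * g j e.2 - if (i, j) ∈ M then 1 else 0| ≤ 1 / 4 := by
  have hle1 : ∀ a b, |g a b| ≤ 1 := by
    intro a b
    by_cases h : a = b
    · subst h; simp [hg1]
    · linarith [hg2 a b h]
  -- Unless `e = (i, j)`, at least one factor is an off-diagonal Gram entry.
  have hterm : ∀ e : V × V,
      |g i e.1 * g j e.2 - if e = (i, j) then 1 else 0| ≤ 1 / 32 := by
    rintro ⟨a, b⟩
    by_cases he : (a, b) = (i, j)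
    · obtain ⟨rfl, rfl⟩ := Prod.mk.inj he
      simp [hg1]
    · rw [if_neg he, sub_zero, abs_mul]
      by_cases ha : i = a
      · have hb : j ≠ b := fun hb => he (by rw [ha, hb])
        calc |g i a| * |g j b| ≤ 1 * (1 / 32) :=
              mul_le_mul (hle1 _ _) (hg2 _ _ hb) (abs_nonneg _) zero_le_one
          _ = _ := one_mul _
      · calc |g i a| * |g j b| ≤ (1 / 32) * 1 :=
              mul_le_mul (hg2 _ _ ha) (hle1 _ _) (abs_nonneg _) (by norm_num)
          _ = _ := mul_one _
  -- The edge `(i, j)` meets `i`, so the indicator belongs entirely to the incident part. The error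
  -- budget is `4 / 32 + 3 / 24 = 1 / 4`.
  have hind : (if (i, j) ∈ M then (1 : ℝ) else 0) =
      ∑ e ∈ M.filter (fun e => ¬ (e.1 ≠ i ∧ e.1 ≠ j ∧ e.2 ≠ i ∧ e.2 ≠ j)),
        if e = (i, j) then 1 else 0 := by
    rw [Finset.sum_ite_eq']
    simp
  have hsplit := Finset.sum_filter_add_sum_filter_not M
    (fun e => e.1 ≠ i ∧ e.1 ≠ j ∧ e.2 ≠ i ∧ e.2 ≠ j) fun e => g i e.1 * g j e.2
  have hfib := Finset.sum_fiberwise (M.filter fun e => e.1 ≠ i ∧ e.1 ≠ j ∧ e.2 ≠ i ∧ e.2 ≠ j) col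
    fun e => g i e.1 * g j e.2
  have h4 : |∑ e ∈ M.filter (fun e => ¬ (e.1 ≠ i ∧ e.1 ≠ j ∧ e.2 ≠ i ∧ e.2 ≠ j)),
      (g i e.1 * g j e.2 - if e = (i, j) then 1 else 0)| ≤ 1 / 8 := by
    refine (Finset.abs_sum_le_sum_abs _ _).trans ((Finset.sum_le_card_nsmul _ _ _
      fun e _ => hterm e).trans ?_)
    have : ((M.filter fun e => ¬ (e.1 ≠ i ∧ e.1 ≠ j ∧ e.2 ≠ i ∧ e.2 ≠ j)).card : ℝ) ≤ 4 := by
      exact_mod_cast hM.card_incident_le i j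
    rw [nsmul_eq_mul]
    linarith
  rw [Finset.sum_sub_distrib, ← hind] at h4
  rw [Fin.sum_univ_three] at hfib
  have h5 := abs_le.1 h4
  have h6 := abs_le.1 (hg3 0)
  have h7 := abs_le.1 (hg3 1)
  have h8 := abs_le.1 (hg3 2)
  rw [abs_le]
  constructor <;> linarith

variable {d : ℕ}

/-- The embedding of the vertices represents the matching `M` well at the pair `(i, j)`. -/
def GoodEmbedding [DecidableEq V] (M : Finset (V × V)) (i j : V) (X : V → Fin d → ℝ) : Prop :=
  |∑ e ∈ M, (X i ⬝ᵥ X e.1) * (X j ⬝ᵥ X e.2) - if (i, j) ∈ M then 1 else 0| ≤ 1 / 4 ∧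
    ∑ e ∈ M, (X i ⬝ᵥ X e.1) ^ 2 ≤ 101 ∧ ∑ e ∈ M, (X j ⬝ᵥ X e.2) ^ 2 ≤ 101

/-- The tail bound concerns rows other than `i`; if `i` is itself an endpoint it adds exactly `1`,
whence `101`. -/
theorem sum_image_sq_le [DecidableEq V] {M : Finset (V × V)} {p : V × V → V}
    (hp : Set.InjOn p M) {i : V} {X : V → Fin d → ℝ} (hX : X i ⬝ᵥ X i = 1)
    (h : ∑ a ∈ (M.image p).erase i, (X i ⬝ᵥ X a) ^ 2 ≤ 100) :
    ∑ e ∈ M, (X i ⬝ᵥ X (p e)) ^ 2 ≤ 101 := by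
  rw [← Finset.sum_image (f := fun a => (X i ⬝ᵥ X a) ^ 2) hp]
  by_cases hi : i ∈ M.image p
  · rw [← Finset.add_sum_erase _ _ hi, hX]
    linarith
  · rw [Finset.erase_eq_of_notMem hi] at h
    linarith

/-- Union bound, all at the slowest rate: `3` per pair of rows, `2` for each of three edge classes,
`1` for each norm, and a null set where rows are not unit. -/
theorem measure_not_goodEmbedding_le [Fintype V] [DecidableEq V] (hd : 1 ≤ d) {M : Finset (V × V)}
    (hM : IsMatching M) (hloop : ∀ e ∈ M, e.1 ≠ e.2) (hcard : M.card ≤ d) (i j : V) :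
    (Measure.pi fun _ : V => rowLaw d) {X | ¬ GoodEmbedding M i j X} ≤
      ((3 * Fintype.card V ^ 2 + 8 : ℕ) : ℝ≥0∞) * eexp (-(1 / 176947200 * d)) := by
  obtain ⟨col, hcol⟩ := exists_three_colouring M hM
  let N (c : Fin 3) : Finset (V × V) :=
    (M.filter fun e => e.1 ≠ i ∧ e.1 ≠ j ∧ e.2 ≠ i ∧ e.2 ≠ j).filter fun e => col e = c
  have hNM : ∀ c, N c ⊆ M := fun c => (Finset.filter_subset _ _).trans (Finset.filter_subset _ _)
  set ρ := Measure.pi fun _ : V => rowLaw d with hρ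
  set r : ℝ≥0∞ := eexp (-(1 / 176947200 * d)) with hr
  have hinj1 : Set.InjOn Prod.fst (M : Set (V × V)) := fun e he f hf h => hM.eq_of_fst he hf h
  have hinj2 : Set.InjOn Prod.snd (M : Set (V × V)) := fun e he f hf h => hM.eq_of_snd he hf h
  let B1 : V × V → Set (V → Fin d → ℝ) := fun p => {X | p.1 ≠ p.2 ∧ 1 / 32 ≤ |X p.1 ⬝ᵥ X p.2|}
  let B2 : Fin 3 → Set (V → Fin d → ℝ) := fun c =>
    {X | 1 / 24 ≤ |∑ e ∈ N c, (X i ⬝ᵥ X e.1) * (X j ⬝ᵥ X e.2)|}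
  let B3 : Set (V → Fin d → ℝ) :=
    {X | 100 ≤ ∑ a ∈ (M.image Prod.fst).erase i, (X i ⬝ᵥ X a) ^ 2}
  let B4 : Set (V → Fin d → ℝ) :=
    {X | 100 ≤ ∑ a ∈ (M.image Prod.snd).erase j, (X j ⬝ᵥ X a) ^ 2}
  let B5 : Set (V → Fin d → ℝ) := {X | ¬ ∀ a, X a ⬝ᵥ X a = 1}
  have hsub : {X | ¬ GoodEmbedding M i j X} ⊆
      (⋃ p, B1 p) ∪ (⋃ c, B2 c) ∪ B3 ∪ B4 ∪ B5 := by
    intro X hX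
    by_contra hnot
    simp only [Set.mem_union, Set.mem_iUnion, not_or, not_exists, B1, B2, B3, B4, B5,
      Set.mem_ofPred_eq, not_and, not_le, not_not] at hnot
    obtain ⟨⟨⟨⟨h1, h2⟩, h3⟩, h4⟩, h5⟩ := hnot
    refine hX ⟨?_, ?_, ?_⟩
    · exact abs_sum_matching_sub_le hM i j (fun a b => X a ⬝ᵥ X b) h5
        (fun a b hab => (h1 (a, b) hab).le) col fun c => (h2 c).le
    · exact sum_image_sq_le hinj1 (h5 i) h3.le
    · exact sum_image_sq_le hinj2 (h5 j) h4.le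
  have hrate : ∀ t : ℝ, 1 / 176947200 ≤ t → eexp (-(t * d)) ≤ r := fun t ht =>
    eexp_mono (neg_le_neg (by gcongr))
  have h1 : ρ (⋃ p, B1 p) ≤ ((3 * Fintype.card V ^ 2 : ℕ) : ℝ≥0∞) * r := by
    refine (measure_iUnion_fintype_le _ _).trans ?_
    have : ∀ p ∈ (Finset.univ : Finset (V × V)), ρ (B1 p) ≤ 3 * r := by
      intro p _
      by_cases hp : p.1 = p.2
      · simp [B1, hp]
      · refine (measure_mono fun X hX => hX.2).trans
          ((measure_abs_dotProduct_ge_le hd hp).trans ?_)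
        gcongr
        exact hrate _ (by norm_num)
    refine (Finset.sum_le_card_nsmul _ _ _ this).trans (le_of_eq ?_)
    rw [nsmul_eq_mul, Finset.card_univ, Fintype.card_prod]
    push_cast
    ring
  have h2 : ρ (⋃ c, B2 c) ≤ 6 * r := by
    refine (measure_iUnion_fintype_le _ _).trans ?_
    have : ∀ c ∈ (Finset.univ : Finset (Fin 3)), ρ (B2 c) ≤ 2 * r := by
      intro c _
      refine measure_abs_sum_disjoint_edges_ge_le hd i j
        ((Finset.card_le_card (hNM c)).trans hcard) (fun e he => hloop e (hNM c he))
        (fun e he => ?_) fun e he f hf hef => ?_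
      · simp only [N, Finset.mem_filter] at he
        exact he.1.2
      · refine hcol e (hNM c he) f (hNM c hf) hef ?_
        simp only [N, Finset.mem_filter] at he hf
        rw [he.2, hf.2]
    refine (Finset.sum_le_card_nsmul _ _ _ this).trans (le_of_eq ?_)
    rw [nsmul_eq_mul, Finset.card_univ, Fintype.card_fin]
    rw [← mul_assoc]
    norm_num
  have h34 : ∀ (a : V) (p : V × V → V),
      ρ {X | 100 ≤ ∑ b ∈ (M.image p).erase a, (X a ⬝ᵥ X b) ^ 2} ≤ r := by
    intro a p
    refine (measure_sum_sq_dotProduct_ge_le hd (Finset.notMem_erase _ _)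
      ((Finset.card_le_card (Finset.erase_subset _ _)).trans
        (Finset.card_image_le.trans hcard))).trans ?_
    simpa using hrate 1 (by norm_num)
  have h5 : ρ B5 = 0 := ae_pi_rowLaw hd
  calc ρ {X | ¬ GoodEmbedding M i j X}
      ≤ ((((3 * Fintype.card V ^ 2 : ℕ) : ℝ≥0∞) * r + 6 * r) + r + r) + 0 := by
        refine (measure_mono hsub).trans ?_
        refine (measure_union_le _ _).trans (add_le_add ?_ h5.le)
        refine (measure_union_le _ _).trans (add_le_add ?_ (h34 j Prod.snd))
        refine (measure_union_le _ _).trans (add_le_add ?_ (h34 i Prod.fst))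
        exact (measure_union_le _ _).trans (add_le_add h1 h2)
    _ = _ := by
        push_cast
        ring

end MatchingSums

/-! ### Scores as bilinear forms, and the error of one head at one pair -/

section Scores

variable {V : Type*} [Fintype V] {d dk : ℕ}

/-- Push a weight on the edges of `M` forward to the targets. -/
noncomputable def pushTarget [DecidableEq V] (M : Finset (V × V)) (p : V × V → ℝ) (b : V) : ℝ :=
  ∑ e ∈ M, if e.2 = b then p e else 0

theorem sum_pushTarget_mul [DecidableEq V] (M : Finset (V × V)) (p : V × V → ℝ) (w : V → ℝ) :
    ∑ b, pushTarget M p b * w b = ∑ e ∈ M, p e * w e.2 := by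
  simp_rw [pushTarget, Finset.sum_mul]
  rw [Finset.sum_comm]
  refine Finset.sum_congr rfl fun e _ => ?_
  simp [ite_mul]

/-- Targets in a matching are distinct, so pushing forward preserves inner products. This carries
the norm and mean from edges to vertices, which index the signatures. -/
theorem sum_pushTarget_mul_pushTarget [DecidableEq V] {M : Finset (V × V)} (hM : IsMatching M)
    (p q : V × V → ℝ) :
    ∑ b, pushTarget M p b * pushTarget M q b = ∑ e ∈ M, p e * q e := by
  rw [sum_pushTarget_mul]
  refine Finset.sum_congr rfl fun e he => ?_
  rw [pushTarget, Finset.sum_eq_single_of_mem e he fun f hf hne => ?_]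
  · simp
  · exact if_neg fun h => hne (hM.eq_of_snd hf he h)

/-- At most one edge of a matching leaves `a`, so the chosen target is the only one and the choice
disappears into a sum. -/
theorem queryTemplate_apply [DecidableEq V] {M : Finset (V × V)} (hM : IsMatching M)
    (W : Matrix V (Fin dk) ℝ) (a : V) (c : Fin dk) :
    queryTemplate M W a c = ∑ e ∈ M, if e.1 = a then W e.2 c else 0 := by
  unfold queryTemplate
  by_cases h : ∃ j, (a, j) ∈ M
  · rw [dif_pos h, Finset.sum_eq_single_of_mem (a, h.choose) h.choose_spec fun f hf hne => ?_]
    · simp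
    · exact if_neg fun hfa => hne (hM.eq_of_fst hf h.choose_spec hfa)
  · rw [dif_neg h, Finset.sum_eq_zero fun e he => ?_]
    · rfl
    · exact if_neg fun hea : e.1 = a => h ⟨e.2, hea ▸ he⟩

theorem keyTemplate_apply [DecidableEq V] {M : Finset (V × V)} (hM : IsMatching M)
    (W : Matrix V (Fin dk) ℝ) (b : V) (c : Fin dk) :
    keyTemplate M W b c = ∑ e ∈ M, if e.2 = b then W e.2 c else 0 := by
  unfold keyTemplate
  by_cases h : ∃ i, (i, b) ∈ M
  · obtain ⟨i, hi⟩ := h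
    rw [if_pos ⟨i, hi⟩, Finset.sum_eq_single_of_mem (i, b) hi fun f hf hne => ?_]
    · simp
    · exact if_neg fun hfb => hne (hM.eq_of_snd hf hi hfb)
  · rw [if_neg h, Finset.sum_eq_zero fun e he => ?_]
    · rfl
    · exact if_neg fun heb : e.2 = b => h ⟨e.1, heb ▸ he⟩

/-- The score as a bilinear form in the signatures of the targets. -/
theorem score_construction [DecidableEq V] {G : Digraph V} {h : ℕ} (P : EdgePacking G d h)
    (X : Matrix V (Fin d) ℝ) (W : Matrix V (Fin dk) ℝ) (k : Fin h) (i j : V) :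
    (construction P X W).score X k i j =
      ∑ c, (∑ e ∈ P.M k, (X i ⬝ᵥ X e.1) * W e.2 c) * ∑ e ∈ P.M k, (X j ⬝ᵥ X e.2) * W e.2 c := by
  have hq : ∀ c, (X i ᵥ* (Xᵀ * queryTemplate (P.M k) W)) c =
      ∑ e ∈ P.M k, (X i ⬝ᵥ X e.1) * W e.2 c := by
    intro c
    rw [← Matrix.vecMul_vecMul]
    simp only [Matrix.vecMul, dotProduct, queryTemplate_apply (P.matching k), Finset.mul_sum]
    rw [Finset.sum_comm]
    refine Finset.sum_congr rfl fun e _ => ?_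
    simp [Matrix.transpose_apply]
  have hk : ∀ c, (X j ᵥ* (Xᵀ * keyTemplate (P.M k) W)) c =
      ∑ e ∈ P.M k, (X j ⬝ᵥ X e.2) * W e.2 c := by
    intro c
    rw [← Matrix.vecMul_vecMul]
    simp only [Matrix.vecMul, dotProduct, keyTemplate_apply (P.matching k), Finset.mul_sum]
    rw [Finset.sum_comm]
    refine Finset.sum_congr rfl fun e _ => ?_
    simp [Matrix.transpose_apply]
  simp only [AttentionParams.score, AttentionParams.query, AttentionParams.key, construction]
  rw [dotProduct]
  exact Finset.sum_congr rfl fun c _ => by rw [hq, hk]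

theorem drawLaw_eq (V : Type*) [Fintype V] (d dk : ℕ) :
    drawLaw V d dk = (Measure.pi fun _ : V => rowLaw d).prod (rademacherMatrix V dk) := by
  rw [drawLaw, map_normalizeRows]

instance : IsProbabilityMeasure (drawLaw V d dk) := by
  rw [drawLaw_eq]
  infer_instance

/-- A single head gives the right answer at a single pair, except with small probability. -/
theorem drawLaw_score_error_le [DecidableEq V] {G : Digraph V} (hG : ∀ v, ¬ G.Adj v v) {h : ℕ}
    (hd : 1 ≤ d) (hdk : 1 ≤ dk) (P : EdgePacking G d h) (k : Fin h) (i j : V) :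
    drawLaw V d dk {p | ¬ |(construction P p.1 p.2).score p.1 k i j -
        dk * if (i, j) ∈ P.M k then 1 else 0| < (dk : ℝ) / 2} ≤
      ((3 * Fintype.card V ^ 2 + 8 : ℕ) : ℝ≥0∞) * eexp (-(1 / 176947200 * d)) +
        2 * eexp (-(1 / 1337065472 * dk)) := by
  set M := P.M k with hMdef
  have hM : IsMatching M := P.matching k
  have hloop : ∀ e ∈ M, e.1 ≠ e.2 := by
    intro e he h'
    have hadj : e ∈ edges G := (P.mem_iff e).2 ⟨k, he⟩
    simp only [edges, Finset.mem_filter] at hadj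
    exact hG e.1 (by simpa [← h'] using hadj.2)
  let F : (V → Fin d → ℝ) × (V → Fin dk → ℝ) → ℝ := fun p =>
    ∑ c, (∑ e ∈ M, (p.1 i ⬝ᵥ p.1 e.1) * p.2 e.2 c) * ∑ e ∈ M, (p.1 j ⬝ᵥ p.1 e.2) * p.2 e.2 c
  let m : (V → Fin d → ℝ) → ℝ := fun X => ∑ e ∈ M, (X i ⬝ᵥ X e.1) * (X j ⬝ᵥ X e.2)
  have hdk' : (1 : ℝ) ≤ dk := by exact_mod_cast hdk
  -- Including the good embedding in the event makes every section over `X` either empty or covered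
  -- by the sign concentration.
  let Bad : Set ((V → Fin d → ℝ) × (V → Fin dk → ℝ)) :=
    {p | GoodEmbedding M i j p.1 ∧ (dk : ℝ) / 8 ≤ |F p - dk * m p.1|}
  have hsub : {p : (V → Fin d → ℝ) × (V → Fin dk → ℝ) |
      ¬ |(construction P p.1 p.2).score p.1 k i j - dk * if (i, j) ∈ M then 1 else 0| <
        (dk : ℝ) / 2} ⊆ ({X | ¬ GoodEmbedding M i j X} ×ˢ Set.univ) ∪ Bad := by
    rintro ⟨X, W⟩ hp
    by_contra hnot
    simp only [Set.mem_union, Set.mem_prod, Set.mem_univ, and_true, not_or, Bad,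
      Set.mem_ofPred_eq, not_and, not_not, not_le] at hnot
    refine hp ?_
    have h1 := hnot.1.1
    have h2 := hnot.2 hnot.1
    have hscore : (construction P X W).score X k i j = F (X, W) := score_construction P X W k i j
    simp only [hscore]
    have h1' := abs_le.1 h1
    have h2' := abs_lt.1 h2
    have h3 := mul_le_mul_of_nonneg_left h1'.1 (by linarith : (0 : ℝ) ≤ dk)
    have h4 := mul_le_mul_of_nonneg_left h1'.2 (by linarith : (0 : ℝ) ≤ dk)
    simp only [m] at h2'
    -- The two errors add up to less than `dk / 4 + dk / 8 < dk / 2`.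
    rw [abs_lt]
    constructor <;> nlinarith
  have hgood : MeasurableSet {X : V → Fin d → ℝ | GoodEmbedding M i j X} := by
    have hm : Measurable fun X : V → Fin d → ℝ => |m X - if (i, j) ∈ M then 1 else 0| := by
      simp only [m]
      fun_prop
    have h1 : Measurable fun X : V → Fin d → ℝ => ∑ e ∈ M, (X i ⬝ᵥ X e.1) ^ 2 := by fun_prop
    have h2 : Measurable fun X : V → Fin d → ℝ => ∑ e ∈ M, (X j ⬝ᵥ X e.2) ^ 2 := by fun_prop
    exact (measurableSet_le hm measurable_const).inter
      ((measurableSet_le h1 measurable_const).inter (measurableSet_le h2 measurable_const))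
  have hBad : MeasurableSet Bad := by
    have hF : Measurable fun p => |F p - dk * m p.1| := by
      simp only [F, m]
      fun_prop
    exact (measurable_fst hgood).inter (measurableSet_le measurable_const hF)
  rw [drawLaw_eq]
  refine (measure_mono hsub).trans ((measure_union_le _ _).trans (add_le_add ?_ ?_))
  · rw [Measure.prod_prod, measure_univ, mul_one]
    exact measure_not_goodEmbedding_le hd hM hloop (P.card_le k) i j
  · rw [Measure.prod_apply hBad]
    have hsec : ∀ X : V → Fin d → ℝ, rademacherMatrix V dk (Prod.mk X ⁻¹' Bad) ≤
        2 * eexp (-(1 / 1337065472 * dk)) := by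
      intro X
      by_cases hX : GoodEmbedding M i j X
      · have h := measure_abs_bilinear_ge_le dk
          (u := pushTarget M fun e => X i ⬝ᵥ X e.1) (v := pushTarget M fun e => X j ⬝ᵥ X e.2)
          (by simp_rw [sq, sum_pushTarget_mul_pushTarget hM, ← sq]; exact hX.2.1)
          (by simp_rw [sq, sum_pushTarget_mul_pushTarget hM, ← sq]; exact hX.2.2)
        simp only [sum_pushTarget_mul_pushTarget hM] at h
        refine (measure_mono fun W hW => ?_).trans h
        have hcol : ∀ (p : V × V → ℝ) (c : Fin dk),
            ∑ b, pushTarget M p b * W b c = ∑ e ∈ M, p e * W e.2 c := fun p c =>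
          sum_pushTarget_mul M p fun b => W b c
        simp only [Set.mem_ofPred_eq, hcol]
        exact hW.2
      · have : Prod.mk X ⁻¹' Bad = ∅ := by
          ext W
          simp [Bad, hX]
        rw [this, measure_empty]
        exact zero_le
    exact (lintegral_mono hsec).trans (by simp)

/-- An edge needs only the head that contains it, a non-edge needs all heads. Strictness survives
the supremum because there are finitely many heads; with none it is `⊥`. -/
theorem separates_of_forall_abs_lt [DecidableEq V] {G : Digraph V} {h : ℕ}
    (P : EdgePacking G d h) (X : Matrix V (Fin d) ℝ) (W : Matrix V (Fin dk) ℝ)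
    (hs : ∀ k i j, |(construction P X W).score X k i j - dk * if (i, j) ∈ P.M k then 1 else 0| <
      (dk : ℝ) / 2) : Separates G (construction P X W) X := by
  have hedge : ∀ i j, (i, j) ∈ edges G ↔ G.Adj i j := fun i j => by simp [edges]
  intro i j
  constructor
  · intro hij
    obtain ⟨k, hk⟩ := (P.mem_iff (i, j)).1 ((hedge i j).2 hij)
    have h1 := (abs_lt.1 (hs k i j)).1
    rw [if_pos hk] at h1
    refine lt_of_lt_of_le ?_ (le_iSup
      (fun k => (((construction P X W).score X k i j : ℝ) : EReal)) k)
    rw [EReal.coe_lt_coe_iff]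
    simp only [construction] at h1 ⊢
    linarith
  · intro hij
    rw [AttentionParams.scoreMax, ← Finset.sup_univ_eq_iSup,
      Finset.sup_lt_iff (EReal.bot_lt_coe _)]
    intro k _
    have hk : (i, j) ∉ P.M k := fun hk => hij ((hedge i j).1 ((P.mem_iff (i, j)).2 ⟨k, hk⟩))
    have h1 := (abs_lt.1 (hs k i j)).2
    rw [if_neg hk] at h1
    rw [EReal.coe_lt_coe_iff]
    simp only [construction] at h1 ⊢
    linarith

end Scores

/-! ### Union bound over heads and pairs, and the final constants -/

theorem eexp_neg_le_inv_pow {m : ℕ} (hm : 1 ≤ m) {κ x : ℝ} (n : ℕ)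
    (h : n * Real.log m ≤ κ * x) : eexp (-(κ * x)) ≤ ENNReal.ofReal (((m : ℝ) ^ n)⁻¹) := by
  refine ENNReal.ofReal_le_ofReal ?_
  have hm0 : (0 : ℝ) < m := by exact_mod_cast hm
  rw [Real.exp_neg]
  refine inv_anti₀ (by positivity) ?_
  calc (m : ℝ) ^ n = Real.exp (n * Real.log m) := by rw [Real.exp_nat_mul, Real.exp_log hm0]
    _ ≤ _ := Real.exp_le_exp.2 h

/-- There are at most `2 * m ^ 4` events, each of probability at most `4 / m ^ 10`, and `8 / m ^ 6 ≤
1 / m ^ 3` once `m ≥ 2`. -/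
theorem union_bound_le {m h : ℕ} (hm : 2 ≤ m) (hh : h ≤ 2 * m ^ 2) :
    ((h * m ^ 2 : ℕ) : ℝ) * ((3 * m ^ 2 + 8 : ℕ) * ((m : ℝ) ^ 14)⁻¹ + 2 * ((m : ℝ) ^ 10)⁻¹) ≤
      1 / (m : ℝ) ^ 3 := by
  have hm2 : (2 : ℝ) ≤ m := by exact_mod_cast hm
  have hm0 : (0 : ℝ) < m := by linarith
  have hh' : (h : ℝ) ≤ 2 * (m : ℝ) ^ 2 := by exact_mod_cast hh
  have h4 : (4 : ℝ) ≤ (m : ℝ) ^ 2 := by nlinarith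
  have h16 : (16 : ℝ) ≤ (m : ℝ) ^ 4 := by nlinarith
  have h8 : (8 : ℝ) ≤ (m : ℝ) ^ 3 := by nlinarith
  have h1 : ((3 * m ^ 2 + 8 : ℕ) : ℝ) * ((m : ℝ) ^ 14)⁻¹ + 2 * ((m : ℝ) ^ 10)⁻¹ ≤
      4 * ((m : ℝ) ^ 10)⁻¹ := by
    have : ((m : ℝ) ^ 10)⁻¹ = (m : ℝ) ^ 4 * ((m : ℝ) ^ 14)⁻¹ := by field_simp
    rw [this]
    push_cast
    have hinv : 0 ≤ ((m : ℝ) ^ 14)⁻¹ := by positivity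
    have : 3 * (m : ℝ) ^ 2 + 8 ≤ 2 * (m : ℝ) ^ 4 := by nlinarith
    nlinarith
  calc ((h * m ^ 2 : ℕ) : ℝ) *
        ((3 * m ^ 2 + 8 : ℕ) * ((m : ℝ) ^ 14)⁻¹ + 2 * ((m : ℝ) ^ 10)⁻¹)
      ≤ (2 * (m : ℝ) ^ 4) * (4 * ((m : ℝ) ^ 10)⁻¹) := by
        refine mul_le_mul ?_ h1 (by positivity) (by positivity)
        push_cast
        nlinarith
    _ = 8 / (m : ℝ) ^ 6 := by field_simp; norm_num
    _ ≤ 1 / (m : ℝ) ^ 3 := by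
        rw [div_le_div_iff₀ (by positivity) (by positivity)]
        have : (m : ℝ) ^ 6 = (m : ℝ) ^ 3 * (m : ℝ) ^ 3 := by ring
        nlinarith [pow_pos hm0 3]

/-- Every packing gives a correct construction, except with probability at most `m⁻³`. -/
theorem drawLaw_separates_ge {V : Type*} [Fintype V] {G : Digraph V} (hG : ∀ v, ¬ G.Adj v v)
    {d dk h : ℕ} (hd : 1 ≤ d) (hh : h ≤ 2 * Fintype.card V ^ 2)
    (hdm : 14 * 176947200 * Real.log (Fintype.card V) ≤ d)
    (hdkm : 10 * 1337065472 * Real.log (Fintype.card V) ≤ dk) (P : EdgePacking G d h) :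
    1 - 1 / (Fintype.card V : ℝ) ^ 3 ≤
      (drawLaw V d dk).real {p | Separates G (construction P p.1 p.2) p.1} := by
  classical
  -- For `m = 0` the convention `1 / 0 = 0` demands probability one, and separation is vacuous; for
  -- `m = 1` the lower bound is `0`.
  rcases Nat.lt_or_ge (Fintype.card V) 2 with hm | hm
  · interval_cases hc : Fintype.card V
    · have : IsEmpty V := Fintype.card_eq_zero_iff.1 hc
      have hS : {p : (V → Fin d → ℝ) × (V → Fin dk → ℝ) |
          Separates G (construction P p.1 p.2) p.1} = Set.univ :=
        Set.eq_univ_of_forall fun p i => isEmptyElim i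
      rw [hS]
      simp
    · norm_num
  · set m := Fintype.card V with hmdef
    have hlog : 0 < Real.log m := Real.log_pos (by exact_mod_cast hm)
    have hdk : 1 ≤ dk := by
      have : (0 : ℝ) < dk := lt_of_lt_of_le (by positivity) hdkm
      exact_mod_cast this
    set S := {p : (V → Fin d → ℝ) × (V → Fin dk → ℝ) |
      Separates G (construction P p.1 p.2) p.1} with hS
    let E (q : Fin h × V × V) : Set ((V → Fin d → ℝ) × (V → Fin dk → ℝ)) :=
      {p | ¬ |(construction P p.1 p.2).score p.1 q.1 q.2.1 q.2.2 -
        dk * if (q.2.1, q.2.2) ∈ P.M q.1 then 1 else 0| < (dk : ℝ) / 2}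
    have hsub : Sᶜ ⊆ ⋃ q, E q := by
      intro p hp
      by_contra hnot
      simp only [Set.mem_iUnion, not_exists, E, Set.mem_ofPred_eq, not_not] at hnot
      exact hp (separates_of_forall_abs_lt P p.1 p.2 fun k i j => hnot (k, i, j))
    have hE : ∀ q ∈ (Finset.univ : Finset (Fin h × V × V)), drawLaw V d dk (E q) ≤
        ENNReal.ofReal ((3 * m ^ 2 + 8 : ℕ) * ((m : ℝ) ^ 14)⁻¹ + 2 * ((m : ℝ) ^ 10)⁻¹) := by
      intro q _
      refine (drawLaw_score_error_le hG hd hdk P q.1 q.2.1 q.2.2).trans ?_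
      rw [ENNReal.ofReal_add (by positivity) (by positivity), ENNReal.ofReal_mul (by positivity),
        ENNReal.ofReal_mul (by positivity), ENNReal.ofReal_natCast, ENNReal.ofReal_ofNat]
      refine add_le_add (mul_le_mul_right ?_ _) (mul_le_mul_right ?_ _)
      · exact eexp_neg_le_inv_pow (by omega) 14 (by push_cast; linarith)
      · exact eexp_neg_le_inv_pow (by omega) 10 (by push_cast; linarith)
    have hbad : drawLaw V d dk Sᶜ ≤ ENNReal.ofReal (1 / (m : ℝ) ^ 3) := by
      refine (measure_mono hsub).trans ((measure_iUnion_fintype_le _ _).trans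
        ((Finset.sum_le_card_nsmul _ _ _ hE).trans ?_))
      rw [nsmul_eq_mul, ← ENNReal.ofReal_natCast, ← ENNReal.ofReal_mul (by positivity)]
      refine ENNReal.ofReal_le_ofReal ?_
      have hcard : (Finset.univ : Finset (Fin h × V × V)).card = h * m ^ 2 := by
        rw [Finset.card_univ, Fintype.card_prod, Fintype.card_prod, Fintype.card_fin, sq]
      rw [hcard]
      exact union_bound_le hm hh
    have hbad' : (drawLaw V d dk).real Sᶜ ≤ 1 / (m : ℝ) ^ 3 :=
      ENNReal.toReal_le_of_le_ofReal (by positivity) hbad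
    -- Subadditivity suffices, so measurability of `S` is not needed.
    have hone : (1 : ℝ) ≤ (drawLaw V d dk).real S + (drawLaw V d dk).real Sᶜ := by
      have := measureReal_union_le (μ := drawLaw V d dk) S Sᶜ
      rwa [Set.union_compl_self, probReal_univ] at this
    linarith

/-- The total key dimension is of order `(m' / d + Δ) log m`. -/
theorem numHeads_mul_headWidth_le {V : Type*} [Fintype V] (G : Digraph V)
    (d : ℕ) {C : ℝ} (hC : 0 < C) :
    ((numHeads G d * headWidth C (Fintype.card V) : ℕ) : ℝ) ≤
      2 * (C + 2) * (((numEdges G : ℝ) / d + maxDegree G) * Real.log (Fintype.card V)) := by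
  have hH := numHeads_le_two_mul G (d := d)
  have h0 : (0 : ℝ) ≤ (numEdges G : ℝ) / d + maxDegree G := by positivity
  rcases Nat.lt_or_ge (Fintype.card V) 2 with hm | hm
  · have hw : headWidth C (Fintype.card V) = 0 := by
      interval_cases h : Fintype.card V <;> simp [headWidth]
    have hlog : Real.log (Fintype.card V) = 0 := by
      interval_cases h : Fintype.card V <;> simp
    simp [hw, hlog]
  · have hm2 : (2 : ℝ) ≤ Fintype.card V := by exact_mod_cast hm
    -- This turns the `+ 1` of the ceiling into at most `2 * log m`, hence the factor `C + 2`.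
    have hlog : 1 / 2 ≤ Real.log (Fintype.card V) := by
      have := Real.log_le_log (by norm_num) hm2
      linarith [Real.log_two_gt_d9]
    have hw : (headWidth C (Fintype.card V) : ℝ) ≤ (C + 2) * Real.log (Fintype.card V) := by
      have := Nat.ceil_lt_add_one (a := C * Real.log (Fintype.card V)) (by positivity)
      rw [headWidth]
      linarith
    push_cast
    calc (numHeads G d : ℝ) * headWidth C (Fintype.card V)
        ≤ (2 * ((numEdges G : ℝ) / d + maxDegree G)) *
          ((C + 2) * Real.log (Fintype.card V)) :=
          mul_le_mul hH hw (Nat.cast_nonneg _) (by positivity)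
      _ = _ := by ring

end RGR

theorem mainTheorem3 :
    ∃ c₀ : ℝ, 0 < c₀ ∧ ∃ C₀ : ℝ, 0 < C₀ ∧ ∀ C : ℝ, C₀ ≤ C → ∃ K : ℝ, 0 < K ∧
      ∀ (V : Type*) [Fintype V] (G : Digraph V) (d : ℕ),
        (∀ v, ¬ G.Adj v v) → 1 ≤ d → c₀ * Real.log (Fintype.card V) ≤ d →
        -- an edge colouring with `Δ` colours, batched into `⌈m' / d⌉ + Δ` matchings of size `≤ d`
        (∃ col : V × V → ℕ, RGR.IsEdgeColoring G (RGR.maxDegree G) col ∧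
          ∃ P : RGR.EdgePacking G d (RGR.numHeads G d),
            ∀ k, ∀ e ∈ P.M k, ∀ f ∈ P.M k, col e = col f) ∧
        -- every packing into that many matchings of size `≤ d` gives a correct construction
        ∀ P : RGR.EdgePacking G d (RGR.numHeads G d),
          1 - 1 / (Fintype.card V : ℝ) ^ 3 ≤
            (RGR.drawLaw V d (RGR.headWidth C (Fintype.card V))).real
              {p | RGR.Separates G (RGR.construction P p.1 p.2) p.1} ∧
          ∀ (X : Matrix V (Fin d) ℝ)
            (W : Matrix V (Fin (RGR.headWidth C (Fintype.card V))) ℝ),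
            ((RGR.construction P X W).totalKeyDim : ℝ) ≤
              K * (((RGR.numEdges G : ℝ) / d + RGR.maxDegree G) *
                Real.log (Fintype.card V)) := by
  -- Inverse decay rates times the powers of `m` wanted: `m⁻¹⁴` for the embedding, whose failure
  -- bound carries a factor `O(m ^ 2)`, and `m⁻¹⁰` for the signatures.
  refine ⟨14 * 176947200, by norm_num, 10 * 1337065472, by norm_num, fun C hC =>
    ⟨2 * (C + 2), by linarith, fun V _ G d hG hd hdm =>
      ⟨RGR.exists_edgeColoring_and_packing G hd, fun P =>
        ⟨RGR.drawLaw_separates_ge hG hd (RGR.numHeads_le G hd) hdm ?_ P, fun X W => ?_⟩⟩⟩⟩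
  · refine le_trans ?_ (Nat.le_ceil _)
    exact mul_le_mul_of_nonneg_right hC (Real.log_natCast_nonneg _)
  · exact RGR.numHeads_mul_headWidth_le G d (by linarith)
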